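/- Label the levels of an infinite interlacing array $(x_i^{(n)})_{0\le i\le n,\ n\ge 0}$ of non-negative integers from $0$, with $x_0^{(n)}<\dots<x_n^{(n)}$ at level $n$ and interlacing $x_i^{(n+1)}\le x_i^{(n)}<x_{i+1}^{(n+1)}$ for $0\le i\le n$. Let $\mathbb{IA}_\infty$ be the set of such arrays and let $\mathbb{IA}^*_\infty$ be the set of those for which, for every $i$, $x_i^{(n)}=i$ for all sufficiently large $n$. Define $\mathsf{Hgt}$ on $\mathbb{IA}_\infty^*$ by $$\mathsf{Hgt}(\mathbf x)_i^{(j)}=\mathsf h_i(j)+i,\qquad \mathsf h_i(j)=\#\{n\ge i: x_i^{(n)}>j\},\qquad 0\le i\le j .$$ Let $\theta:\mathbb Z_+\times\mathbb Z_+\to(0,\infty)$ be an environment; $\theta(x,y)$ is attached to space location $x$ and level $y$. Put $\hat\theta(x,y)=\theta(y,x)$. Consider the following dynamics in $\mathbb{IA}_\infty$ in environment $\theta$. * *Continuous-time pure-birth* (assuming $\inf\theta>0$, $\sup\theta<\infty$): a particle $X_i^{(n)}$ at location $x$ attempts to jump to $x+1$ at rate $\theta(x,n)$. The jump is suppressed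 if $X_i^{(n-1)}=x$. Otherwise it jumps, and if $X_{i+1}^{(n+1)}=x+1$ then this particle is instantaneously pushed to $x+2$, the pushing being propagated to higher levels. Paths are right-continuous. * *Sequential-update Bernoulli* (discrete time, assuming $\inf\theta>0$, $\sup\theta<1$): in each time-step levels are updated from bottom to top. A particle $X_i^{(n)}$ at location $x$ is moved to $x+1$ if the updated location of $X_{i-1}^{(n-1)}$ is $x$; it stays at $x$ if the updated location of $X_i^{(n-1)}$ is $x$; otherwise, independently, it moves to $x+1$ with probability $\theta(x,n)$ and stays at $x$ with probability $1-\theta(x,n)$. * *Warren–Windridge geometric* (discrete time, assuming $\inf\theta>0$, $\sup\theta<1$): in each time-step levels are updated from bottom to top. A particle $X_i^{(n)}$ at location $x$ is first moved to $z=\max(x,x'+1)$, where $x'$ is the updated location of $X_{i-1}^{(n-1)}$ ($z=x$ if $i=0$). Then, independently, it attempts to jump to $w\ge z$ with probability $(1-\theta(w,n))\prod_{l=z}^{w-1}\theta(l,n)$; its new location is $\min(w,b)$, where $b$ is the location of $X_i^{(n-1)}$ before the time-step (and it is $w$ if $i=n$). **Theorem.** The map $\mathsf{Hgt}$ takes $\mathbb{IA}^*_\infty$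 to itself and is an involution. Let $\mathbf x\in\mathbb{IA}^*_\infty$, let $\theta$ satisfy the corresponding condition above, and let $(X(t))_{t\ge0}$ with $X(0)=\mathbf x$ evolve according to (a) the continuous-time pure-birth, (b) the sequential-update Bernoulli, (c) the Warren–Windridge geometric dynamics in environment $\theta$. Then almost surely $X(t)\in\mathbb{IA}^*_\infty$ for all $t\ge 0$, and the process $(\mathsf{Hgt}(X(t)))_{t\ge0}$ evolves, respectively, according to (a) the continuous-time pure-birth, (b) the Warren–Windridge geometric, (c) the sequential-update Bernoulli dynamics in environment $\hat\theta$, with initial condition $\mathsf{Hgt}(\mathbf x)$. -/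

import Mathlib

open MeasureTheory

noncomputable section

namespace HgtDuality

/-! ### Interlacing arrays

Levels are labelled `0, 1, 2, …` and level `n` has the particles `x_0^{(n)} < … < x_n^{(n)}`.
An array is stored column by column: `x i k` is the `k`-th particle of column `i`, that is
`x_i^{(i+k)}`, which lives at level `i + k`. -/

/-- `x_i^{(n+1)} ≤ x_i^{(n)} < x_{i+1}^{(n+1)}` for all `i ≤ n` (here `n = i + k`). -/
def IsInterlacing (x : ℕ → ℕ → ℕ) : Prop :=
  ∀ i k, x i (k + 1) ≤ x i k ∧ x i k < x (i + 1) k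

/-- The particle `x_i^{(n)}`, for `i ≤ n`. -/
def particle (x : ℕ → ℕ → ℕ) (n i : ℕ) : ℕ := x i (n - i)

/-- Check of the column indexing: `IsInterlacing` says that every level is strictly increasing and
that consecutive levels interlace. -/
theorem isInterlacing_iff (x : ℕ → ℕ → ℕ) :
    IsInterlacing x ↔
      (∀ n i, i + 1 ≤ n → particle x n i < particle x n (i + 1)) ∧
      (∀ n i, i ≤ n → particle x (n + 1) i ≤ particle x n i ∧
        particle x n i < particle x (n + 1) (i + 1)) := by
  constructor
  · intro h
    refine ⟨fun n i hi => ?_, fun n i hi => ?_⟩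
    · obtain ⟨k, rfl⟩ := Nat.exists_eq_add_of_le hi
      have h1 : i + 1 + k - i = k + 1 := by omega
      have h2 : i + 1 + k - (i + 1) = k := by omega
      simp only [particle, h1, h2]
      exact lt_of_le_of_lt (h i k).1 (h i k).2
    · obtain ⟨k, rfl⟩ := Nat.exists_eq_add_of_le hi
      have h1 : i + k + 1 - i = k + 1 := by omega
      have h2 : i + k - i = k := by omega
      have h3 : i + k + 1 - (i + 1) = k := by omega
      simp only [particle, h1, h2, h3]
      exact h i k
  · rintro ⟨-, h⟩ i k
    have := h (i + k) i (by omega)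
    have h1 : i + k + 1 - i = k + 1 := by omega
    have h2 : i + k - i = k := by omega
    have h3 : i + k + 1 - (i + 1) = k := by omega
    simpa only [particle, h1, h2, h3] using this

/-- Infinite interlacing arrays, with the product topology and product sigma-algebra. -/
abbrev IA : Type := {x : ℕ → ℕ → ℕ // IsInterlacing x}

/-- Every column with index `i ≥ 1` is eventually at its lowest possible position `i`.
(For column `0` this is then automatic, see `eventually_packed`.) -/
def IsStar (x : ℕ → ℕ → ℕ) : Prop :=
  ∀ i, 1 ≤ i → ∃ K, ∀ k, K ≤ k → x i k = i

/-- Interlacing arrays obtained from the fully packed one by moving finitely many particles in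
each column. -/
abbrev IAstar : Type := {x : IA // IsStar x.1}

theorem eventually_packed {x : ℕ → ℕ → ℕ} (hx : IsInterlacing x) (hs : IsStar x) (i : ℕ) :
    ∃ K, ∀ k, K ≤ k → x i k = i := by
  rcases Nat.eq_zero_or_pos i with rfl | hi
  · obtain ⟨K, hK⟩ := hs 1 le_rfl
    refine ⟨K, fun k hk => ?_⟩
    have h1 := (hx 0 k).2
    have h2 := hK k hk
    simp only [zero_add] at h1
    omega
  · exact hs i hi

/-! ### The height function map -/

/-- `h_i(j) = #{n ≥ i : x_i^{(n)} > j}`. -/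
def height (x : ℕ → ℕ → ℕ) (i j : ℕ) : ℕ := Set.ncard {k : ℕ | j < x i k}

/-- The array whose particle with index `i` at level `j` is at `h_i(j) + i` (here `j = i + k`). -/
def hgtFun (x : ℕ → ℕ → ℕ) : ℕ → ℕ → ℕ := fun i k => height x i (i + k) + i

theorem finite_above {x : ℕ → ℕ → ℕ} (hx : IsInterlacing x) (hs : IsStar x) (i k : ℕ) :
    {m : ℕ | i + k < x i m}.Finite := by
  obtain ⟨K, hK⟩ := eventually_packed hx hs i
  refine (Set.finite_Iio K).subset fun m hm => ?_
  by_contra hlt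
  have := hK m (by simpa using hlt)
  simp only [Set.mem_ofPred_eq] at hm
  omega

theorem hgtFun_interlacing {x : ℕ → ℕ → ℕ} (hx : IsInterlacing x) (hs : IsStar x) :
    IsInterlacing (hgtFun x) := by
  intro i k
  constructor
  · have : height x i (i + (k + 1)) ≤ height x i (i + k) :=
      Set.ncard_le_ncard (fun m hm => by simp only [Set.mem_ofPred_eq] at hm ⊢; omega)
        (finite_above hx hs i k)
    simpa only [hgtFun, add_le_add_iff_right] using this
  · have : height x i (i + k) ≤ height x (i + 1) (i + 1 + k) :=
      Set.ncard_le_ncard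
        (fun m hm => by
          have := (hx i m).2
          simp only [Set.mem_ofPred_eq] at hm ⊢; omega)
        (finite_above hx hs (i + 1) k)
    simp only [hgtFun]
    omega

theorem antitone_col {x : ℕ → ℕ → ℕ} (hx : IsInterlacing x) (i m : ℕ) : x i m ≤ x i 0 :=
  antitone_nat_of_succ_le (fun k => (hx i k).1) (Nat.zero_le m)

theorem hgtFun_star {x : ℕ → ℕ → ℕ} (hx : IsInterlacing x) : IsStar (hgtFun x) := by
  intro i _
  refine ⟨x i 0, fun k hk => ?_⟩
  have : {m : ℕ | i + k < x i m} = ∅ := by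
    ext m
    have := antitone_col hx i m
    simp only [Set.mem_ofPred_eq, Set.mem_empty_iff_false, iff_false]
    omega
  simp [hgtFun, height, this]

/-- The height function map. -/
def Hgt (x : IAstar) : IAstar :=
  ⟨⟨hgtFun x.1.1, hgtFun_interlacing x.1.2 x.2⟩, hgtFun_star x.1.2⟩

open Classical in
/-- `Hgt` as a map on all interlacing arrays: it is `Hgt` on `IAstar`, and the (irrelevant)
identity elsewhere. -/
def HgtExt (x : IA) : IA := if h : IsStar x.1 then (Hgt ⟨x, h⟩).1 else x

/-! ### Environments -/

/-- `θ x y` is attached to space location `x` and level `y`. Continuous-time condition: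
`0 < inf θ` and `sup θ < ∞`. -/
def ContinuousEnv (θ : ℕ → ℕ → ℝ) : Prop :=
  ∃ c C : ℝ, 0 < c ∧ ∀ x y, c ≤ θ x y ∧ θ x y ≤ C

/-- Discrete-time condition: `0 < inf θ` and `sup θ < 1`. -/
def DiscreteEnv (θ : ℕ → ℕ → ℝ) : Prop :=
  ∃ c C : ℝ, 0 < c ∧ C < 1 ∧ ∀ x y, c ≤ θ x y ∧ θ x y ≤ C

/-- The transposed environment. -/
def transposeEnv (θ : ℕ → ℕ → ℝ) : ℕ → ℕ → ℝ := fun x y => θ y x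

/-! ### Processes -/

/-- The sigma-algebra generated by the process up to and including time `t`. -/
abbrev past {Ω T : Type*} [Preorder T] (X : T → Ω → IA) (t : T) : MeasurableSpace Ω :=
  ⨆ s ∈ Set.Iic t, (inferInstance : MeasurableSpace IA).comap (X s)

/-- The two arrays coincide on the levels `0, …, N - 1`. -/
def AgreeBelow (N : ℕ) (x y : ℕ → ℕ → ℕ) : Prop :=
  ∀ i k, i + k < N → x i k = y i k

/-! ### Continuous-time pure-birth push-block dynamics -/

/-- The particle `(i, k)`, at level `i + k`, is blocked: it has the same location as the particle
with the same index one level below. -/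
def Blocked (x : ℕ → ℕ → ℕ) (i k : ℕ) : Prop := 1 ≤ k ∧ x i (k - 1) = x i k

open Classical in
/-- The array after the particle `(i, k)` jumps to the right by one. The particle
`x_{i+m}^{(n+m)}`, i.e. `(i + m, k)`, moves by one with it if and only if all of
`x_{i+1}^{(n+1)}, …, x_{i+m}^{(n+m)}` are in the way, i.e. are at distances `1, …, m` from
`x_i^{(n)}`. -/
def jump (x : ℕ → ℕ → ℕ) (i k : ℕ) : ℕ → ℕ → ℕ := fun i' k' =>
  if k' = k ∧ i ≤ i' ∧ ∀ m, i + m ≤ i' → x (i + m) k = x i k + m then x i' k' + 1 else x i' k'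

open Classical in
/-- The generator on functions `f` of the first `N` levels: each particle `(i, k)` at level
`i + k < N`, unless it is blocked, jumps at rate `θ (location) (level)`. -/
def generator (θ : ℕ → ℕ → ℝ) (N : ℕ) (f : (ℕ → ℕ → ℕ) → ℝ) (x : ℕ → ℕ → ℕ) : ℝ :=
  ∑ i ∈ Finset.range N, ∑ k ∈ Finset.range (N - i),
    if Blocked x i k then 0 else θ (x i k) (i + k) * (f (jump x i k) - f x)

/-- `X` evolves according to the pure-birth push-block dynamics in environment `θ` started from
`x`: right-continuous paths, and the martingale problem for the generator, tested on the bounded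
functions of finitely many levels (on these the generator is a bounded operator). -/
structure IsPureBirth {Ω : Type*} [MeasurableSpace Ω] (P : Measure Ω) (θ : ℕ → ℕ → ℝ) (x : IA)
    (X : NNReal → Ω → IA) : Prop where
  measurable : ∀ t, Measurable (X t)
  initial : ∀ᵐ ω ∂P, X 0 ω = x
  rightContinuous : ∀ᵐ ω ∂P, ∀ t, ContinuousWithinAt (fun s => X s ω) (Set.Ici t) t
  martingale : ∀ (N : ℕ) (f : (ℕ → ℕ → ℕ) → ℝ),
    (∀ y z, AgreeBelow N y z → f y = f z) → (∃ C, ∀ y, |f y| ≤ C) →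
    ∀ s t : NNReal, s ≤ t →
      P[fun ω => f (X t ω).1 - f (X s ω).1
          - ∫ u in (s : ℝ)..(t : ℝ), generator θ N f (X u.toNNReal ω).1 | past X s] =ᵐ[P] 0

/-! ### Discrete-time dynamics

In one time-step from `x` to `y`, levels are updated from bottom to top. For the particle `(i, k)`
at level `n = i + k`, the particle with the same index one level below is `(i, k - 1)` (if `k ≥ 1`)
and the one with the preceding index one level below is `(i - 1, k)` (if `i ≥ 1`). -/

open Classical in
/-- Probability that the sequential-update Bernoulli rule gives the particle `(i, k)` the new
location `y i k`, given the old array `x` and the new locations `y` at the lower levels. -/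
def bernoulliProb (θ : ℕ → ℕ → ℝ) (x y : ℕ → ℕ → ℕ) (i k : ℕ) : ℝ :=
  if 1 ≤ i ∧ y (i - 1) k = x i k then
    -- pushed by one, and no further move
    if y i k = x i k + 1 then 1 else 0
  else if 1 ≤ k ∧ y i (k - 1) = x i k then
    -- blocked by the updated location of the particle below
    if y i k = x i k then 1 else 0
  else if y i k = x i k + 1 then θ (x i k) (i + k)
  else if y i k = x i k then 1 - θ (x i k) (i + k)
  else 0

/-- Inhomogeneous geometric probability to jump from `z` to `w` at level `n`. -/
def geomProb (θ : ℕ → ℕ → ℝ) (n z w : ℕ) : ℝ :=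
  if z ≤ w then (∏ l ∈ Finset.Ico z w, θ l n) * (1 - θ w n) else 0

/-- Location of the particle `(i, k)` after a possible push by the updated location of the particle
with the preceding index one level below. -/
def pushedLocation (x y : ℕ → ℕ → ℕ) (i k : ℕ) : ℕ :=
  if 1 ≤ i then max (x i k) (y (i - 1) k + 1) else x i k

/-- Probability that the Warren-Windridge geometric rule gives the particle `(i, k)` the new
location `y i k`, given the old array `x` and the new locations `y` at the lower levels: it attempts
a geometric jump from its pushed location, and jumps past the old location of the particle below
are stopped there. -/
def geometricProb (θ : ℕ → ℕ → ℝ) (x y : ℕ → ℕ → ℕ) (i k : ℕ) : ℝ :=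
  if 1 ≤ k then
    ∑' w : ℕ, if min w (x i (k - 1)) = y i k then
      geomProb θ (i + k) (pushedLocation x y i k) w else 0
  else geomProb θ (i + k) (pushedLocation x y i k) (y i k)

/-- `X` is a Markov chain in `IA` started from `x`, such that, given the past, the first `N` levels
of the next array are those of `y` with probability the product, over the particles at these levels,
of the update probabilities `q (current array) y i k`. -/
structure IsSequentialChain {Ω : Type*} [MeasurableSpace Ω] (P : Measure Ω)
    (q : (ℕ → ℕ → ℕ) → (ℕ → ℕ → ℕ) → ℕ → ℕ → ℝ) (x : IA) (X : ℕ → Ω → IA) : Prop where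
  measurable : ∀ t, Measurable (X t)
  initial : ∀ᵐ ω ∂P, X 0 ω = x
  step : ∀ (t N : ℕ) (y : ℕ → ℕ → ℕ),
    P[Set.indicator {ω | AgreeBelow N (X (t + 1) ω).1 y} (fun _ => (1 : ℝ)) | past X t] =ᵐ[P]
      fun ω => ∏ i ∈ Finset.range N, ∏ k ∈ Finset.range (N - i), q (X t ω).1 y i k

/-- Sequential-update Bernoulli push-block dynamics in environment `θ` started from `x`. -/
def IsBernoulli {Ω : Type*} [MeasurableSpace Ω] (P : Measure Ω) (θ : ℕ → ℕ → ℝ) (x : IA)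
    (X : ℕ → Ω → IA) : Prop :=
  IsSequentialChain P (bernoulliProb θ) x X

/-- Warren-Windridge geometric push-block dynamics in environment `θ` started from `x`. -/
def IsWarrenWindridge {Ω : Type*} [MeasurableSpace Ω] (P : Measure Ω) (θ : ℕ → ℕ → ℝ) (x : IA)
    (X : ℕ → Ω → IA) : Prop :=
  IsSequentialChain P (geometricProb θ) x X

end HgtDuality

end

noncomputable section

open Filter Topology

namespace HgtDuality

/-! ### Columns and their conjugates -/

/-! For an array in `IAstar`, the numbers `x i k - i` of column `i` are weakly decreasing in `k` and
eventually zero, so they are the rows of a Young diagram. `hgtFun` transposes each of these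
diagrams: by `add_lt_hgtFun_iff`, the box `(k, l)` lies in one diagram exactly when `(l, k)` lies in
the other. This makes `Hgt` an involution and turns the duality into a statement about boxes.

Pure birth. An unblocked particle `(i, k)` jumps by adding the box `(k, x i k - i)` to diagram `i`,
and a push adds the same box to the next diagrams. Transposing exchanges location and level, so the
rate is read from the transposed environment (`hgtFun_jump`). A finite part of the conjugate array
depends on infinitely many levels of `X`, so the martingale problem is first transferred for the
array cut off at row `M` (`generator_truncatedHgt`), with bounds independent of `M`; then `M` tends
to infinity by dominated convergence. A first-moment bound of the same kind shows that columns stay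
eventually packed.

Discrete time. Transition weights are products over particles. Regrouping the factors of one column
by location instead of by particle turns Bernoulli weights into geometric weights of the conjugate
column (`prod_bernoulliProb`); the converse follows by involution. Eventually packed columns form a
countable set, so the law of the conjugate is obtained by summing over columns. Only upper bounds on
cylinder probabilities are carried along (`sum_prod_le`, `HasWeights.measureReal_hgtExt_le`); they
become equalities because the measure has mass one and the weights have total mass at most one
(`hasWeights_of_le`). Regular conditional laws transfer this to the chains. -/

theorem IsInterlacing.add_le {x : ℕ → ℕ → ℕ} (hx : IsInterlacing x) (i d k : ℕ) :
    x i k + d ≤ x (i + d) k := by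
  induction d with
  | zero => simp
  | succ d ih => have := (hx (i + d) k).2; rw [← add_assoc i d 1]; omega

theorem IsInterlacing.le_apply {x : ℕ → ℕ → ℕ} (hx : IsInterlacing x) (i k : ℕ) : i ≤ x i k := by
  have := hx.add_le 0 i k
  rw [zero_add] at this
  omega

theorem IsInterlacing.antitone {x : ℕ → ℕ → ℕ} (hx : IsInterlacing x) (i : ℕ) :
    Antitone (x i) :=
  antitone_nat_of_succ_le fun k => (hx i k).1

/-- Both sides say that the box `(k, l)` belongs to diagram `i`. A column is antitone, so the
particles beyond a given location form an initial segment, and comparing with its length is the same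
as membership. -/
theorem add_lt_hgtFun_iff {x : ℕ → ℕ → ℕ} (hx : IsInterlacing x) (hs : IsStar x) (i k l : ℕ) :
    i + k < hgtFun x i l ↔ i + l < x i k := by
  classical
  obtain ⟨K, hK⟩ := eventually_packed hx hs i
  have hex : ∃ m, x i m ≤ i + l := ⟨K, by rw [hK K le_rfl]; omega⟩
  have hset : {m : ℕ | i + l < x i m} = Set.Iio (Nat.find hex) := by
    ext m
    simp only [Set.mem_ofPred_eq, Set.mem_Iio, Nat.lt_find_iff, not_le]
    exact ⟨fun h j hj => h.trans_le (hx.antitone i hj), fun h => h m le_rfl⟩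
  have hcard : height x i (i + l) = Nat.find hex := by
    rw [height, hset, Set.ncard_eq_toFinset_card']
    simp
  have hmem : k ∈ {m : ℕ | i + l < x i m} ↔ k < Nat.find hex := by rw [hset]; rfl
  rw [Set.mem_ofPred_eq] at hmem
  rw [hmem, hgtFun, hcard]
  omega

theorem le_hgtFun (x : ℕ → ℕ → ℕ) (i l : ℕ) : i ≤ hgtFun x i l := Nat.le_add_left _ _

theorem eq_of_forall_add_lt_iff {i a b : ℕ} (ha : i ≤ a) (hb : i ≤ b)
    (h : ∀ m, i + m < a ↔ i + m < b) : a = b := by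
  have h1 := h (a - i)
  have h2 := h (b - i)
  omega

theorem hgtFun_hgtFun {x : ℕ → ℕ → ℕ} (hx : IsInterlacing x) (hs : IsStar x) :
    hgtFun (hgtFun x) = x := by
  funext i k
  refine eq_of_forall_add_lt_iff (le_hgtFun _ i k) (hx.le_apply i k) fun m => ?_
  rw [add_lt_hgtFun_iff (hgtFun_interlacing hx hs) (hgtFun_star hx), add_lt_hgtFun_iff hx hs]

theorem Hgt_involutive : Function.Involutive Hgt := fun x =>
  Subtype.ext (Subtype.ext (hgtFun_hgtFun x.1.2 x.2))

theorem hgtFun_congr_column {x y : ℕ → ℕ → ℕ} {i : ℕ} (h : x i = y i) (l : ℕ) :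
    hgtFun x i l = hgtFun y i l := by
  simp only [hgtFun, height, h]

theorem HgtExt_of_star {x : IA} (h : IsStar x.1) : (HgtExt x).1 = hgtFun x.1 := by
  simp [HgtExt, h, Hgt]

/-! ### Jumps -/

theorem jump_of_ne (x : ℕ → ℕ → ℕ) {i k i' k' : ℕ} (h : k' ≠ k) : jump x i k i' k' = x i' k' := by
  simp [jump, h]

theorem jump_of_lt (x : ℕ → ℕ → ℕ) {i k i' k' : ℕ} (h : i' < i) : jump x i k i' k' = x i' k' := by
  simp [jump, h]

theorem le_jump (x : ℕ → ℕ → ℕ) (i k i' k' : ℕ) : x i' k' ≤ jump x i k i' k' := by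
  unfold jump; split_ifs <;> omega

theorem jump_le (x : ℕ → ℕ → ℕ) (i k i' k' : ℕ) : jump x i k i' k' ≤ x i' k' + 1 := by
  unfold jump; split_ifs <;> omega

/-- Blocking guards the weak inequality and pushing the strict one. Pushed particles need no
blocking condition of their own: a chain at distances `1, …, d` from an unblocked particle has room,
since the row below it is spread at least as widely. -/
theorem jump_interlacing {x : ℕ → ℕ → ℕ} (hx : IsInterlacing x) {i k : ℕ}
    (hb : ¬ Blocked x i k) : IsInterlacing (jump x i k) := by
  intro i' m
  constructor
  · by_cases hm : m + 1 = k
    · subst hm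
      rw [jump_of_ne x (show m ≠ m + 1 by omega)]
      unfold jump
      split_ifs with h
      · obtain ⟨-, hi, hc⟩ := h
        obtain ⟨d, rfl⟩ := Nat.exists_eq_add_of_le hi
        have h1 := hc d le_rfl
        have h2 := hx.add_le i d m
        have h3 : x i m ≠ x i (m + 1) := fun h => hb ⟨by omega, by simpa using h⟩
        have h4 := (hx i m).1
        omega
      · exact (hx i' m).1
    · rw [jump_of_ne x hm]
      exact (hx i' m).1.trans (le_jump x i k i' m)
  · by_cases hm : m = k
    · subst hm
      have h0 := (hx i' m).2
      by_cases h : i ≤ i' ∧ ∀ d, i + d ≤ i' → x (i + d) m = x i m + d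
      · by_cases h' : x (i' + 1) m = x i' m + 1
        · have h1 : jump x i m (i' + 1) m = x (i' + 1) m + 1 := by
            unfold jump
            rw [if_pos]
            refine ⟨rfl, by omega, fun d hd => ?_⟩
            rcases Nat.lt_or_ge i' (i + d) with hlt | hle
            · obtain rfl : i' = i + (d - 1) := by omega
              have := h.2 (d - 1) le_rfl
              have e : i + (d - 1) + 1 = i + d := by omega
              rw [e] at h'
              omega
            · exact h.2 d hle
          have := jump_le x i m i' m
          omega
        · have h1 := jump_le x i m i' m
          have h2 := le_jump x i m (i' + 1) m
          omega
      · have h1 : jump x i m i' m = x i' m := by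
          unfold jump
          rw [if_neg]
          rintro ⟨-, h2⟩
          exact h h2
        have h2 := le_jump x i m (i' + 1) m
        omega
    · rw [jump_of_ne x hm, jump_of_ne x hm]
      exact (hx i' m).2

theorem jump_star {x : ℕ → ℕ → ℕ} (hs : IsStar x) (i k : ℕ) : IsStar (jump x i k) := by
  intro i' hi'
  obtain ⟨K, hK⟩ := hs i' hi'
  refine ⟨max K (k + 1), fun m hm => ?_⟩
  rw [jump_of_ne x (by omega), hK m (by omega)]

/-- A particle of the conjugate array that corresponds to an unblocked particle. -/
theorem hgtFun_of_not_blocked {x : ℕ → ℕ → ℕ} (hx : IsInterlacing x) (hs : IsStar x) {i k : ℕ}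
    (hb : ¬ Blocked x i k) : hgtFun x i (x i k - i) = i + k := by
  refine eq_of_forall_add_lt_iff (le_hgtFun _ _ _) (by omega) fun m => ?_
  rw [add_lt_hgtFun_iff hx hs]
  have h0 := hx.le_apply i k
  constructor
  · intro h
    by_contra hlt
    have := hx.antitone i (show k ≤ m by omega)
    omega
  · intro h
    have h1 : m ≤ k - 1 := by omega
    have h2 := hx.antitone i h1
    have h3 : x i (k - 1) ≠ x i k := fun h => hb ⟨by omega, h⟩
    have h4 := hx.antitone i (show k - 1 ≤ k by omega)
    omega

/-- Unblocked means that the next box can be added to the diagram, which is symmetric under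
transposition. -/
theorem not_blocked_hgtFun {x : ℕ → ℕ → ℕ} (hx : IsInterlacing x) (hs : IsStar x) {i k : ℕ}
    (hb : ¬ Blocked x i k) : ¬ Blocked (hgtFun x) i (x i k - i) := by
  rintro ⟨h1, h2⟩
  rw [hgtFun_of_not_blocked hx hs hb] at h2
  have := (add_lt_hgtFun_iff hx hs i k (x i k - i - 1)).2 (by omega)
  omega

theorem hgtFun_jump {x : ℕ → ℕ → ℕ} (hx : IsInterlacing x) (hs : IsStar x) {i k : ℕ}
    (hb : ¬ Blocked x i k) : hgtFun (jump x i k) = jump (hgtFun x) i (x i k - i) := by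
  have h0 := hx.le_apply i k
  have hk := hgtFun_of_not_blocked hx hs hb
  -- Diagrams grow with the column index, so each equality says that the box `(k, x i k - i)` is
  -- still missing from diagram `i + d`. The pushing condition is therefore the same on both sides.
  have key : ∀ d, x (i + d) k = x i k + d ↔
      hgtFun x (i + d) (x i k - i) = hgtFun x i (x i k - i) + d := by
    intro d
    have h1 := hx.add_le i d k
    have h2 := (hgtFun_interlacing hx hs).add_le i d (x i k - i)
    have h3 := add_lt_hgtFun_iff hx hs (i + d) k (x i k - i)
    omega
  funext i' l'
  refine eq_of_forall_add_lt_iff (le_hgtFun _ _ _)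
    ((le_hgtFun _ _ _).trans (le_jump _ _ _ _ _)) fun m => ?_
  rw [add_lt_hgtFun_iff (jump_interlacing hx hb) (jump_star hs i k)]
  have e := add_lt_hgtFun_iff hx hs i' m l'
  unfold jump
  by_cases hc : i ≤ i' ∧ ∀ d, i + d ≤ i' → x (i + d) k = x i k + d
  · obtain ⟨hi, hc⟩ := hc
    have hc' : ∀ d, i + d ≤ i' → hgtFun x (i + d) (x i k - i) = hgtFun x i (x i k - i) + d :=
      fun d hd => (key d).1 (hc d hd)
    obtain ⟨d, rfl⟩ := Nat.exists_eq_add_of_le hi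
    have h1 := hc d le_rfl
    have h2 := hc' d le_rfl
    by_cases hm : m = k <;> by_cases hl : l' = x i k - i
    · subst hm hl
      rw [if_pos ⟨rfl, hi, hc⟩, if_pos ⟨rfl, hi, hc'⟩]
      omega
    · subst hm
      rw [if_pos ⟨rfl, hi, hc⟩, if_neg (fun h => hl h.1)]
      omega
    · subst hl
      rw [if_neg (fun h => hm h.1), if_pos ⟨rfl, hi, hc'⟩]
      omega
    · rw [if_neg (fun h => hm h.1), if_neg (fun h => hl h.1), e]
  · rw [if_neg (fun h => hc h.2), if_neg, e]
    rintro ⟨rfl, hi, h⟩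
    exact hc ⟨hi, fun d hd => (key d).2 (h d hd)⟩


/-! ### Truncation to finitely many rows -/

/-- The array in which all particles of rows `k ≥ M` are put at their lowest positions. -/
def truncate (M : ℕ) (x : ℕ → ℕ → ℕ) : ℕ → ℕ → ℕ := fun i k => if k < M then x i k else i

theorem truncate_of_lt {M k : ℕ} (x : ℕ → ℕ → ℕ) (i : ℕ) (h : k < M) :
    truncate M x i k = x i k := if_pos h

theorem truncate_of_le {M k : ℕ} (x : ℕ → ℕ → ℕ) (i : ℕ) (h : M ≤ k) :
    truncate M x i k = i := if_neg (by omega)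

theorem truncate_interlacing {x : ℕ → ℕ → ℕ} (hx : IsInterlacing x) (M : ℕ) :
    IsInterlacing (truncate M x) := by
  intro i k
  have h1 := hx.le_apply i k
  have h2 := hx i k
  unfold truncate
  constructor <;> split_ifs <;> omega

theorem truncate_star (M : ℕ) (x : ℕ → ℕ → ℕ) : IsStar (truncate M x) :=
  fun i _ => ⟨M, fun _ hk => truncate_of_le x i hk⟩

/-- Pushing stays within one row `k`; this is why the cut-off is by rows and not by levels. -/
theorem truncate_jump {M i k : ℕ} (x : ℕ → ℕ → ℕ) (h : k < M) :
    truncate M (jump x i k) = jump (truncate M x) i k := by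
  funext i' k'
  by_cases hk : k' = k
  · subst hk
    rw [truncate_of_lt _ _ h]
    unfold jump
    classical
    refine if_congr ?_ ?_ ?_ <;> simp only [truncate_of_lt _ _ h]
  · rw [jump_of_ne _ hk]
    simp only [truncate, jump_of_ne _ hk]

theorem truncate_jump_of_le {M i k : ℕ} (x : ℕ → ℕ → ℕ) (h : M ≤ k) :
    truncate M (jump x i k) = truncate M x := by
  funext i' k'
  by_cases hk : k' < M
  · rw [truncate_of_lt _ _ hk, truncate_of_lt _ _ hk, jump_of_ne _ (by omega)]
  · rw [truncate_of_le _ _ (by omega), truncate_of_le _ _ (by omega)]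

theorem blocked_truncate_iff {M i k : ℕ} (x : ℕ → ℕ → ℕ) (h : k < M) :
    Blocked (truncate M x) i k ↔ Blocked x i k := by
  unfold Blocked
  rw [truncate_of_lt _ _ h, truncate_of_lt _ _ (show k - 1 < M by omega)]

/-- The conjugate of the truncated array. -/
def truncatedHgt (M : ℕ) (x : ℕ → ℕ → ℕ) : ℕ → ℕ → ℕ := hgtFun (truncate M x)

/-- The truncated conjugate is a local function: columns below `N` and rows below `M` lie in the
levels below `N + M`. -/
theorem truncatedHgt_agreeBelow {N M : ℕ} {x y : ℕ → ℕ → ℕ} (h : AgreeBelow (N + M) x y) :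
    AgreeBelow N (truncatedHgt M x) (truncatedHgt M y) := by
  intro i l hl
  refine hgtFun_congr_column (funext fun k => ?_) l
  unfold truncate
  split_ifs with hk
  · exact h i k (by omega)
  · rfl

theorem truncatedHgt_eventually_agree {x : ℕ → ℕ → ℕ} (hx : IsInterlacing x) (hs : IsStar x)
    (N : ℕ) : ∃ K, ∀ M, K ≤ M → ∀ i, i < N → truncatedHgt M x i = hgtFun x i := by
  choose K hK using eventually_packed hx hs
  refine ⟨(Finset.range N).sup K, fun M hM i hi => funext fun l => ?_⟩
  refine hgtFun_congr_column (funext fun k => ?_) l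
  have h1 : K i ≤ (Finset.range N).sup K := Finset.le_sup (Finset.mem_range.2 hi)
  unfold truncate
  split_ifs with hk
  · rfl
  · rw [hK i k (by omega)]

theorem AgreeBelow.jump {N : ℕ} {x y : ℕ → ℕ → ℕ} (h : AgreeBelow N x y) (i k : ℕ) :
    AgreeBelow N (jump x i k) (jump y i k) := by
  intro i' k' hk'
  by_cases hk : k' = k
  · subst hk
    by_cases hi : i ≤ i'
    · have h1 : (∀ m, i + m ≤ i' → x (i + m) k' = x i k' + m) ↔
          ∀ m, i + m ≤ i' → y (i + m) k' = y i k' + m := by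
        refine forall_congr' fun m => forall_congr' fun hm => ?_
        rw [h (i + m) k' (by omega), h i k' (by omega)]
      unfold HgtDuality.jump
      classical
      exact if_congr (by rw [h1]) (by rw [h i' k' hk']) (h i' k' hk')
    · rw [jump_of_lt _ (by omega), jump_of_lt _ (by omega), h i' k' hk']
  · rw [jump_of_ne _ hk, jump_of_ne _ hk, h i' k' hk']

theorem jump_agreeBelow_self (x : ℕ → ℕ → ℕ) {N i k : ℕ} (h : N ≤ i + k) :
    AgreeBelow N (jump x i k) x := by
  intro i' k' hk
  unfold HgtDuality.jump
  rw [if_neg]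
  rintro ⟨rfl, h1, -⟩
  omega

/-- The generator without the jumps of particles `(i, l)` at locations beyond `i + M`. -/
def truncatedGenerator (θ : ℕ → ℕ → ℝ) (N M : ℕ) (f : (ℕ → ℕ → ℕ) → ℝ) (y : ℕ → ℕ → ℕ) : ℝ :=
  open Classical in
  ∑ i ∈ Finset.range N, ∑ l ∈ Finset.range (N - i),
    if Blocked y i l ∨ i + M ≤ y i l then 0 else θ (y i l) (i + l) * (f (jump y i l) - f y)

/-- Jump rates of the conjugate array. -/
theorem generator_truncatedHgt (θ : ℕ → ℕ → ℝ) (N M : ℕ) {f : (ℕ → ℕ → ℕ) → ℝ}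
    (hf : ∀ y z, AgreeBelow N y z → f y = f z) {x : ℕ → ℕ → ℕ} (hx : IsInterlacing x) :
    generator θ (N + M) (fun x => f (truncatedHgt M x)) x =
      truncatedGenerator (transposeEnv θ) N M f (truncatedHgt M x) := by
  classical
  have hy := truncate_interlacing hx M
  have hsy := truncate_star M x
  have term : ∀ {i k}, k < M → ¬ Blocked x i k →
      truncatedHgt M x i (x i k - i) = i + k ∧ ¬ Blocked (truncatedHgt M x) i (x i k - i) ∧
        truncatedHgt M (jump x i k) = jump (truncatedHgt M x) i (x i k - i) := by
    intro i k hk hb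
    rw [← blocked_truncate_iff x hk] at hb
    have e := truncate_of_lt x i hk
    rw [← e]
    refine ⟨hgtFun_of_not_blocked hy hsy hb, not_blocked_hgtFun hy hsy hb, ?_⟩
    unfold truncatedHgt
    rw [truncate_jump x hk, hgtFun_jump hy hsy hb]
  unfold generator truncatedGenerator
  -- Columns `i ≥ N` contribute nothing, since `f` only sees the first `N` columns of the conjugate.
  rw [← Finset.sum_subset (Finset.range_subset_range.2 (Nat.le_add_right N M))]
  · refine Finset.sum_congr rfl fun i hi => ?_
    rw [Finset.mem_range] at hi
    -- The conjugate of the particle `(i, k)` sits at level `x i k`, so its jump is invisible to `f`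
    -- unless `x i k < N`.
    have good : ∀ k, (if Blocked x i k then 0 else θ (x i k) (i + k) *
        (f (truncatedHgt M (jump x i k)) - f (truncatedHgt M x))) ≠ 0 →
        k < M ∧ ¬ Blocked x i k ∧ x i k < N := by
      intro k h
      have hb : ¬ Blocked x i k := fun hb => h (if_pos hb)
      rw [if_neg hb] at h
      have hk : k < M := by
        by_contra hk
        apply h
        unfold truncatedHgt
        rw [truncate_jump_of_le x (by omega), sub_self, mul_zero]
      refine ⟨hk, hb, ?_⟩
      by_contra hN
      apply h
      have := hx.le_apply i k
      rw [(term hk hb).2.2, hf _ _ (jump_agreeBelow_self _ (by omega)), sub_self, mul_zero]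
    have value : ∀ k, k < M → ¬ Blocked x i k →
        (if Blocked x i k then 0 else θ (x i k) (i + k) *
          (f (truncatedHgt M (jump x i k)) - f (truncatedHgt M x))) =
        if Blocked (truncatedHgt M x) i (x i k - i) ∨ i + M ≤ truncatedHgt M x i (x i k - i)
        then 0 else transposeEnv θ (truncatedHgt M x i (x i k - i)) (i + (x i k - i)) *
          (f (jump (truncatedHgt M x) i (x i k - i)) - f (truncatedHgt M x)) := by
      intro k hk hb
      obtain ⟨h1, h2, h3⟩ := term hk hb
      have := hx.le_apply i k
      have e : i + (x i k - i) = x i k := by omega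
      rw [if_neg hb, if_neg (by rintro (h | h); exacts [h2 h, by omega]), h1, h3, e]
      rfl
    -- Within a column, jumps are matched by `k ↦ x i k - i`. The location of the conjugate particle
    -- recovers `k`, and surjectivity is the same correspondence applied to the conjugate array.
    refine Finset.sum_bij_ne_zero (fun k _ _ => x i k - i) ?_ ?_ ?_ ?_
    · intro k _ h
      have := good k h
      have := hx.le_apply i k
      rw [Finset.mem_range]
      omega
    · intro k _ h k' _ h' e
      obtain ⟨a, b, -⟩ := good k h
      obtain ⟨a', b', -⟩ := good k' h'
      have h1 := (term a b).1
      have h2 := (term a' b').1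
      rw [e] at h1
      omega
    · intro l hl h
      have hl' : ¬ (Blocked (truncatedHgt M x) i l ∨ i + M ≤ truncatedHgt M x i l) :=
        fun hb => h (if_pos hb)
      rw [not_or] at hl'
      obtain ⟨hb, hM⟩ := hl'
      have h0 := le_hgtFun (truncate M x) i l
      change i ≤ truncatedHgt M x i l at h0
      have hk : truncatedHgt M x i l - i < M := by omega
      have h1 := hgtFun_of_not_blocked (hgtFun_interlacing hy hsy) (hgtFun_star hy) hb
      have h2 := not_blocked_hgtFun (hgtFun_interlacing hy hsy) (hgtFun_star hy) hb
      rw [hgtFun_hgtFun hy hsy] at h1 h2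
      change truncate M x i (truncatedHgt M x i l - i) = i + l at h1
      change ¬ Blocked (truncate M x) i (truncatedHgt M x i l - i) at h2
      rw [truncate_of_lt _ _ hk] at h1
      rw [blocked_truncate_iff x hk] at h2
      have e : x i (truncatedHgt M x i l - i) - i = l := by omega
      refine ⟨truncatedHgt M x i l - i, Finset.mem_range.2 (by omega), ?_, e⟩
      rw [value _ hk h2, e]
      exact h
    · intro k _ h
      obtain ⟨a, b, -⟩ := good k h
      exact value k a b
  · intro i _ hi
    rw [Finset.mem_range] at hi
    refine Finset.sum_eq_zero fun k _ => ?_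
    split_ifs with hb
    · rfl
    · have : f (truncatedHgt M (jump x i k)) = f (truncatedHgt M x) := by
        refine hf _ _ fun i' l' h' => hgtFun_congr_column (funext fun k' => ?_) l'
        simp only [truncate, jump_of_lt x (show i' < i by omega)]
      simp only [this, sub_self, mul_zero]

theorem truncatedGenerator_eventually_eq (θ : ℕ → ℕ → ℝ) (N : ℕ) {f : (ℕ → ℕ → ℕ) → ℝ}
    (hf : ∀ y z, AgreeBelow N y z → f y = f z) {x : ℕ → ℕ → ℕ} (hx : IsInterlacing x)
    (hs : IsStar x) : ∃ K, ∀ M, K ≤ M →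
      truncatedGenerator θ N M f (truncatedHgt M x) = generator θ N f (hgtFun x) := by
  obtain ⟨K, hK⟩ := truncatedHgt_eventually_agree hx hs N
  -- `hgtFun x N 0` dominates every location in the columns below `N`, so the cut-off at `i + M`
  -- becomes void.
  refine ⟨max K (hgtFun x N 0), fun M hM => ?_⟩
  have hK' := hK M (by omega)
  unfold generator truncatedGenerator
  refine Finset.sum_congr rfl fun i hi => Finset.sum_congr rfl fun l hl => ?_
  rw [Finset.mem_range] at hi hl
  have e := hK' i hi
  have h1 : hgtFun x i l < i + M := by
    have hz := hgtFun_interlacing hx hs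
    obtain ⟨d, rfl⟩ := Nat.exists_eq_add_of_lt hi
    have h2 : hgtFun x i 0 + (d + 1) ≤ hgtFun x (i + d + 1) 0 := hz.add_le i (d + 1) 0
    have h3 := hz.antitone i (Nat.zero_le l)
    omega
  have h4 : ¬ (i + M ≤ truncatedHgt M x i l) := by rw [e]; omega
  have h5 : Blocked (truncatedHgt M x) i l ↔ Blocked (hgtFun x) i l := by
    unfold Blocked; rw [e]
  classical
  refine if_congr (by rw [or_iff_left h4, h5]) rfl ?_
  · have hA : AgreeBelow N (truncatedHgt M x) (hgtFun x) := fun a b hab => by rw [hK' a (by omega)]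
    rw [e, hf _ _ (hA.jump i l), hf _ _ hA]

/-! ### Bounds and locality of the generators -/

theorem abs_sum_triangle_le {a : ℕ → ℕ → ℝ} {D : ℝ} (h : ∀ i k, |a i k| ≤ D) (N : ℕ) :
    |∑ i ∈ Finset.range N, ∑ k ∈ Finset.range (N - i), a i k| ≤ N * (N * D) := by
  have hD : 0 ≤ D := (abs_nonneg _).trans (h 0 0)
  refine (Finset.abs_sum_le_sum_abs _ _).trans ?_
  refine (Finset.sum_le_card_nsmul _ _ (N * D) fun i _ => ?_).trans (by simp)
  refine (Finset.abs_sum_le_sum_abs _ _).trans ?_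
  refine (Finset.sum_le_card_nsmul _ _ D fun l _ => h i l).trans ?_
  rw [nsmul_eq_mul, Finset.card_range]
  exact mul_le_mul_of_nonneg_right (mod_cast Nat.sub_le N i) hD

/-- The bound does not involve `M`, which permits the limit `M → ∞`. Only increments of `f` along
jumps are controlled, so that unbounded coordinate functions are allowed. -/
theorem abs_truncatedGenerator_le {θ : ℕ → ℕ → ℝ} {C B : ℝ} (hθ : ∀ a b, 0 ≤ θ a b ∧ θ a b ≤ C)
    (N M : ℕ) {f : (ℕ → ℕ → ℕ) → ℝ} (y : ℕ → ℕ → ℕ)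
    (hf : ∀ i k, |f (jump y i k) - f y| ≤ B) :
    |truncatedGenerator θ N M f y| ≤ N * (N * (C * B)) := by
  have hC : 0 ≤ C := (hθ 0 0).1.trans (hθ 0 0).2
  refine abs_sum_triangle_le (fun i l => ?_) N
  split_ifs
  · simpa using mul_nonneg hC ((abs_nonneg _).trans (hf 0 0))
  · rw [abs_mul, abs_of_nonneg (hθ _ _).1]
    exact mul_le_mul (hθ _ _).2 (hf i l) (abs_nonneg _) hC

theorem abs_generator_le {θ : ℕ → ℕ → ℝ} {C B : ℝ} (hθ : ∀ a b, 0 ≤ θ a b ∧ θ a b ≤ C)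
    (N : ℕ) {f : (ℕ → ℕ → ℕ) → ℝ} (y : ℕ → ℕ → ℕ)
    (hf : ∀ i k, |f (jump y i k) - f y| ≤ B) :
    |generator θ N f y| ≤ N * (N * (C * B)) := by
  have hC : 0 ≤ C := (hθ 0 0).1.trans (hθ 0 0).2
  refine abs_sum_triangle_le (fun i l => ?_) N
  split_ifs
  · simpa using mul_nonneg hC ((abs_nonneg _).trans (hf 0 0))
  · rw [abs_mul, abs_of_nonneg (hθ _ _).1]
    exact mul_le_mul (hθ _ _).2 (hf i l) (abs_nonneg _) hC

theorem generator_congr (θ : ℕ → ℕ → ℝ) (N : ℕ) {f : (ℕ → ℕ → ℕ) → ℝ}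
    (hf : ∀ y z, AgreeBelow N y z → f y = f z) {x y : ℕ → ℕ → ℕ} (h : AgreeBelow N x y) :
    generator θ N f x = generator θ N f y := by
  unfold generator
  refine Finset.sum_congr rfl fun i hi => Finset.sum_congr rfl fun k hk => ?_
  rw [Finset.mem_range] at hi hk
  have h1 := h i k (by omega)
  have h2 : Blocked x i k ↔ Blocked y i k := by
    unfold Blocked; rw [h1, h i (k - 1) (by omega)]
  classical
  exact if_congr h2 rfl (by rw [h1, hf _ _ (h.jump i k), hf _ _ h])


/-! ### Measurability on the space of arrays -/

theorem measurable_apply (i k : ℕ) : Measurable fun x : IA => x.1 i k :=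
  (measurable_pi_apply k).comp ((measurable_pi_apply i).comp measurable_subtype_coe)

/-- Such a function factors through a finite block of coordinates, which takes values in a countable
discrete space. -/
theorem measurable_of_agreeBelow {β : Type*} [MeasurableSpace β] {N : ℕ} {f : (ℕ → ℕ → ℕ) → β}
    (hf : ∀ y z, AgreeBelow N y z → f y = f z) : Measurable fun x : IA => f x.1 := by
  have h1 : Measurable fun p : Fin N → Fin N → ℕ =>
      f fun i k => if h : i < N ∧ k < N then p ⟨i, h.1⟩ ⟨k, h.2⟩ else 0 :=
    measurable_of_countable _
  have h2 : Measurable fun (x : IA) (i k : Fin N) => x.1 i k :=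
    measurable_pi_lambda _ fun i => measurable_pi_lambda _ fun k => measurable_apply i k
  convert h1.comp h2 using 2 with x
  refine hf _ _ fun i k hik => ?_
  simp [show i < N ∧ k < N by omega]

theorem measurableSet_agreeBelow (N : ℕ) (y : ℕ → ℕ → ℕ) :
    MeasurableSet {x : IA | AgreeBelow N x.1 y} := by
  have : Measurable fun x : IA => AgreeBelow N x.1 y :=
    measurable_of_agreeBelow (N := N) (f := fun z => AgreeBelow N z y) fun z w h => propext
      ⟨fun h' i k hk => (h i k hk).symm.trans (h' i k hk), fun h' i k hk =>
        (h i k hk).trans (h' i k hk)⟩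
  exact measurableSet_setOfPred.2 this

theorem measurableSet_star : MeasurableSet {x : IA | IsStar x.1} := by
  have h : ∀ i k, MeasurableSet {x : IA | x.1 i k = i} := fun i k =>
    measurable_apply i k (measurableSet_singleton i)
  have e : {x : IA | IsStar x.1} =
      ⋂ i, ⋂ _ : 1 ≤ i, ⋃ K, ⋂ k, ⋂ _ : K ≤ k, {x : IA | x.1 i k = i} := by
    ext x; simp [IsStar]
  rw [e]
  exact .iInter fun i => .iInter fun _ => .iUnion fun K => .iInter fun k => .iInter fun _ => h i k

theorem measurable_HgtExt : Measurable HgtExt := by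
  have key : ∀ i l, Measurable fun x : IA => (HgtExt x).1 i l := by
    intro i l
    refine measurable_of_Ioi fun c => ?_
    -- On starred arrays each event concerns a single coordinate, by box duality.
    have e : (fun x : IA => (HgtExt x).1 i l) ⁻¹' Set.Ioi c =
        ({x : IA | IsStar x.1} ∩ {x : IA | c < i ∨ i + l < x.1 i (c - i)}) ∪
          ({x : IA | IsStar x.1}ᶜ ∩ {x : IA | c < x.1 i l}) := by
      ext x
      by_cases hs : IsStar x.1
      · have h0 := le_hgtFun x.1 i l
        have h1 := add_lt_hgtFun_iff x.2 hs i (c - i) l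
        simp only [Set.mem_preimage, HgtExt_of_star hs, Set.mem_Ioi, Set.mem_union, Set.mem_inter_iff,
          Set.mem_ofPred_eq, hs, Set.mem_compl_iff, not_true, true_and, false_and, or_false]
        omega
      · simp [HgtExt, hs]
    have h1 : MeasurableSet {x : IA | i + l < x.1 i (c - i)} :=
      measurable_apply i (c - i) measurableSet_Ioi
    have h2 : MeasurableSet {x : IA | c < x.1 i l} := measurable_apply i l measurableSet_Ioi
    rw [e]
    exact (measurableSet_star.inter ((MeasurableSet.const _).union h1)).union
      (measurableSet_star.compl.inter h2)
  exact Measurable.subtype_mk (measurable_pi_lambda _ fun i => measurable_pi_lambda _ fun l => key i l)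

/-! ### Right-continuous paths -/

theorem eventually_agreeBelow {T : Type*} [TopologicalSpace T] {X : T → IA} {S : Set T} {t : T}
    (h : ContinuousWithinAt X S t) (N : ℕ) : ∀ᶠ s in 𝓝[S] t, AgreeBelow N (X s).1 (X t).1 := by
  have h1 : ∀ i k, ∀ᶠ s in 𝓝[S] t, (X s).1 i k = (X t).1 i k := by
    intro i k
    have hc : Continuous fun x : IA => x.1 i k :=
      (continuous_apply k).comp ((continuous_apply i).comp continuous_subtype_val)
    have := (hc.continuousAt.tendsto.comp h)
    exact this.eventually (p := fun m => m = (X t).1 i k) (by rw [nhds_discrete]; rfl)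
  have h2 : ∀ᶠ s in 𝓝[S] t, ∀ i ∈ Finset.range N, ∀ k ∈ Finset.range N,
      (X s).1 i k = (X t).1 i k :=
    (Finset.eventually_all _).2 fun i _ => (Finset.eventually_all _).2 fun k _ => h1 i k
  filter_upwards [h2] with s hs i k hik
  exact hs i (Finset.mem_range.2 (by omega)) k (Finset.mem_range.2 (by omega))

theorem continuousWithinAt_of_eventually {T : Type*} [TopologicalSpace T] {X : T → IA} {S : Set T}
    {t : T} (h : ∀ i k, ∀ᶠ s in 𝓝[S] t, (X s).1 i k = (X t).1 i k) :
    ContinuousWithinAt X S t := by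
  rw [ContinuousWithinAt, tendsto_subtype_rng]
  refine tendsto_pi_nhds.2 fun i => tendsto_pi_nhds.2 fun k => ?_
  exact tendsto_const_nhds.congr' ((h i k).mono fun s hs => hs.symm)

/-- Times in a grid of mesh `1 / (n + 1)` that approximate `v` from the right. -/
def gridTime (n : ℕ) (v : NNReal) : NNReal := (⌊(n + 1) * v⌋₊ + 1) / (n + 1)

theorem tendsto_gridTime (v : NNReal) :
    Tendsto (fun n => gridTime n v) atTop (𝓝[Set.Ici v] v) := by
  have hle : ∀ n, v ≤ gridTime n v := fun n => by
    rw [gridTime, le_div_iff₀ (by positivity), mul_comm]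
    exact (Nat.lt_floor_add_one _).le
  refine tendsto_nhdsWithin_iff.2 ⟨?_, Eventually.of_forall hle⟩
  have hup : ∀ n : ℕ, gridTime n v ≤ v + 1 / ((n : NNReal) + 1) := fun n => by
    have h0 : (n : NNReal) + 1 ≠ 0 := by positivity
    have h1 : (v + 1 / ((n : NNReal) + 1)) * (n + 1) = (n + 1) * v + 1 := by field_simp
    rw [gridTime, div_le_iff₀ (by positivity), h1]
    gcongr
    exact Nat.floor_le (by positivity)
  refine tendsto_of_tendsto_of_tendsto_of_le_of_le tendsto_const_nhds ?_ hle hup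
  have h1 : Tendsto (fun n : ℕ => 1 / ((n : NNReal) + 1)) atTop (𝓝 0) :=
    tendsto_one_div_add_atTop_nhds_zero_nat
  simpa using tendsto_const_nhds.add h1

theorem measurable_gridTime_comp {β : Type*} [MeasurableSpace β] (n : ℕ) (g : NNReal → β) :
    Measurable fun u : ℝ => g (gridTime n u.toNNReal) := by
  have h1 : Measurable fun m : ℕ => g ((m + 1) / (n + 1)) := measurable_from_nat
  exact h1.comp (Nat.measurable_floor.comp (measurable_real_toNNReal.const_mul _))

section Paths

variable {Ω : Type*} [MeasurableSpace Ω] {P : Measure Ω} {X : NNReal → Ω → IA}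
  {N : ℕ} {f : (ℕ → ℕ → ℕ) → ℝ}

theorem tendsto_gridTime_comp (hf : ∀ y z, AgreeBelow N y z → f y = f z) {Y : NNReal → IA}
    (hY : ∀ t, ContinuousWithinAt Y (Set.Ici t) t) (v : NNReal) :
    Tendsto (fun n => f (Y (gridTime n v)).1) atTop (𝓝 (f (Y v).1)) :=
  tendsto_const_nhds.congr' <| ((tendsto_gridTime v).eventually
    (eventually_agreeBelow (hY v) N)).mono fun _ hn => (hf _ _ hn).symm

theorem measurable_path (hf : ∀ y z, AgreeBelow N y z → f y = f z) {Y : NNReal → IA}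
    (hY : ∀ t, ContinuousWithinAt Y (Set.Ici t) t) :
    Measurable fun u : ℝ => f (Y u.toNNReal).1 :=
  measurable_of_tendsto_metrizable
    (fun n => measurable_gridTime_comp n fun t => f (Y t).1)
    (tendsto_pi_nhds.2 fun u => tendsto_gridTime_comp hf hY u.toNNReal)

/-- Along grid times the path is jointly measurable in `ω` and `u`, because only countably many
times occur. Right-continuity and the bound `B` pass the integrals to the limit. -/
theorem aestronglyMeasurable_integral_path (hf : ∀ y z, AgreeBelow N y z → f y = f z) {B : ℝ}
    (hB : ∀ y, |f y| ≤ B) (hm : ∀ t, Measurable (X t))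
    (hX : ∀ᵐ ω ∂P, ∀ t, ContinuousWithinAt (fun s => X s ω) (Set.Ici t) t) (s t : ℝ) :
    AEStronglyMeasurable (fun ω => ∫ u in s..t, f (X u.toNNReal ω).1) P := by
  refine aestronglyMeasurable_of_tendsto_ae (u := atTop)
    (f := fun n ω => ∫ u in s..t, f (X (gridTime n u.toNNReal) ω).1) (fun n => ?_) ?_
  · have h1 : Measurable fun p : Ω × ℕ => f (X ((p.2 + 1) / (n + 1)) p.1).1 :=
      measurable_from_prod_countable_left fun m =>
        (measurable_of_agreeBelow hf).comp (hm ((m + 1) / (n + 1)))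
    have h2 : Measurable fun p : Ω × ℝ => (p.1, ⌊((n : NNReal) + 1) * p.2.toNNReal⌋₊) :=
      measurable_fst.prodMk
        (Nat.measurable_floor.comp ((measurable_real_toNNReal.comp measurable_snd).const_mul _))
    have h3 : Measurable fun p : Ω × ℝ => f (X (gridTime n p.2.toNNReal) p.1).1 := by
      simpa only [Function.comp_def, gridTime] using h1.comp h2
    have h4 : ∀ S : Set ℝ, StronglyMeasurable fun ω =>
        ∫ u in S, f (X (gridTime n u.toNNReal) ω).1 := fun S =>
      h3.stronglyMeasurable.integral_prod_right'
    exact ((h4 _).sub (h4 _)).aestronglyMeasurable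
  · filter_upwards [hX] with ω hω
    refine intervalIntegral.tendsto_integral_filter_of_dominated_convergence (fun _ => B) ?_ ?_ ?_ ?_
    · exact Eventually.of_forall fun n =>
        (measurable_gridTime_comp n fun t => f (X t ω).1).aestronglyMeasurable
    · exact Eventually.of_forall fun n => Eventually.of_forall fun u _ => hB _
    · simp
    · exact Eventually.of_forall fun u _ => tendsto_gridTime_comp hf hω u.toNNReal

end Paths


/-! ### The past of a process -/

theorem past_le {Ω T : Type*} [MeasurableSpace Ω] [Preorder T] {X : T → Ω → IA}
    (h : ∀ t, Measurable (X t)) (t : T) : past X t ≤ (inferInstance : MeasurableSpace Ω) :=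
  iSup₂_le fun s _ => (h s).comap_le

theorem measurable_past {Ω T : Type*} [Preorder T] (X : T → Ω → IA) {s t : T} (h : s ≤ t) :
    Measurable[past X t] (X s) := by
  have h1 : (inferInstance : MeasurableSpace IA).comap (X s) ≤ past X t :=
    le_iSup₂_of_le (f := fun s (_ : s ∈ Set.Iic t) => (inferInstance : MeasurableSpace IA).comap (X s))
      s h le_rfl
  exact measurable_iff_comap_le.2 h1

theorem past_comp_le {Ω T : Type*} [Preorder T] (X : T → Ω → IA) {φ : IA → IA}
    (hφ : Measurable φ) (t : T) : past (fun s ω => φ (X s ω)) t ≤ past X t :=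
  iSup₂_le fun _ hs => (hφ.comp (measurable_past X hs)).comap_le

/-! ### Pure-birth dynamics -/

theorem abs_sub_le_of_abs_le {f : (ℕ → ℕ → ℕ) → ℝ} {B : ℝ} (hB : ∀ y, |f y| ≤ B)
    (y z : ℕ → ℕ → ℕ) : |f y - f z| ≤ 2 * B := by
  have h1 := abs_le.1 (hB y)
  have h2 := abs_le.1 (hB z)
  exact abs_le.2 ⟨by linarith, by linarith⟩

/-- The increment of the martingale of a test function. -/
def compensated {Ω : Type*} (θ : ℕ → ℕ → ℝ) (N : ℕ) (f : (ℕ → ℕ → ℕ) → ℝ) (X : NNReal → Ω → IA)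
    (s t : NNReal) (ω : Ω) : ℝ :=
  f (X t ω).1 - f (X s ω).1 - ∫ u in (s : ℝ)..(t : ℝ), generator θ N f (X u.toNNReal ω).1

namespace IsPureBirth

variable {Ω : Type*} [MeasurableSpace Ω] {P : Measure Ω}
  {θ : ℕ → ℕ → ℝ} {x : IA} {X : NNReal → Ω → IA} {C : ℝ} {N : ℕ} {f : (ℕ → ℕ → ℕ) → ℝ} {B : ℝ}

theorem aestronglyMeasurable_integral (h : IsPureBirth P θ x X)
    (hθ : ∀ a b, 0 ≤ θ a b ∧ θ a b ≤ C) (hf : ∀ y z, AgreeBelow N y z → f y = f z)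
    (hB : ∀ y, |f y| ≤ B) (s t : ℝ) :
    AEStronglyMeasurable (fun ω => ∫ u in s..t, generator θ N f (X u.toNNReal ω).1) P :=
  aestronglyMeasurable_integral_path (fun _ _ => generator_congr θ N hf)
    (fun y => abs_generator_le hθ N y fun _ _ => abs_sub_le_of_abs_le hB _ _)
    h.measurable h.rightContinuous s t

variable [IsProbabilityMeasure P]

theorem integrable_apply (h : IsPureBirth P θ x X) (hf : ∀ y z, AgreeBelow N y z → f y = f z)
    (hB : ∀ y, |f y| ≤ B) (t : NNReal) : Integrable (fun ω => f (X t ω).1) P :=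
  Integrable.of_bound (((measurable_of_agreeBelow hf).comp (h.measurable t)).aestronglyMeasurable)
    B (Eventually.of_forall fun _ => hB _)

theorem integrable_integral (h : IsPureBirth P θ x X)
    (hθ : ∀ a b, 0 ≤ θ a b ∧ θ a b ≤ C) (hf : ∀ y z, AgreeBelow N y z → f y = f z)
    (hB : ∀ y, |f y| ≤ B) (s t : ℝ) :
    Integrable (fun ω => ∫ u in s..t, generator θ N f (X u.toNNReal ω).1) P :=
  Integrable.of_bound (h.aestronglyMeasurable_integral hθ hf hB s t)
    (N * (N * (C * (2 * B))) * |t - s|) (Eventually.of_forall fun _ =>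
      intervalIntegral.norm_integral_le_of_norm_le_const fun _ _ =>
        abs_generator_le hθ N _ fun _ _ => abs_sub_le_of_abs_le hB _ _)

theorem integrable_compensated (h : IsPureBirth P θ x X)
    (hθ : ∀ a b, 0 ≤ θ a b ∧ θ a b ≤ C) (hf : ∀ y z, AgreeBelow N y z → f y = f z)
    (hB : ∀ y, |f y| ≤ B) (s t : NNReal) : Integrable (compensated θ N f X s t) P :=
  ((h.integrable_apply hf hB t).sub (h.integrable_apply hf hB s)).sub
    (h.integrable_integral hθ hf hB s t)

theorem setIntegral_compensated (h : IsPureBirth P θ x X)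
    (hθ : ∀ a b, 0 ≤ θ a b ∧ θ a b ≤ C) (hf : ∀ y z, AgreeBelow N y z → f y = f z)
    (hB : ∀ y, |f y| ≤ B) {s t : NNReal} (hst : s ≤ t) {A : Set Ω}
    (hA : MeasurableSet[past X s] A) : ∫ ω in A, compensated θ N f X s t ω ∂P = 0 := by
  have hm := past_le h.measurable s
  rw [← setIntegral_condExp hm (h.integrable_compensated hθ hf hB s t) hA]
  have h0 : P[compensated θ N f X s t | past X s] =ᵐ[P] 0 := h.martingale N f hf ⟨B, hB⟩ s t hst
  rw [setIntegral_congr_ae (g := fun _ => 0) (hm _ hA) (h0.mono fun ω hω _ => hω)]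
  simp

/-- The indicator of `c ≤ y i k` can only increase along jumps, so its generator is nonnegative. On
the past event where it already equals its maximum `1`, minus the compensated increment is
nonnegative with integral zero, hence vanishes, and the indicator cannot drop. -/
theorem ae_le_of_le (h : IsPureBirth P θ x X) (hθ : ∀ a b, 0 ≤ θ a b ∧ θ a b ≤ C)
    {s t : NNReal} (hst : s ≤ t) (i k c : ℕ) :
    ∀ᵐ ω ∂P, c ≤ (X s ω).1 i k → c ≤ (X t ω).1 i k := by
  set f : (ℕ → ℕ → ℕ) → ℝ := fun y => if c ≤ y i k then 1 else 0 with hfdef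
  have hf : ∀ y z, AgreeBelow (i + k + 1) y z → f y = f z := fun y z hyz => by
    simp only [hfdef, hyz i k (by omega)]
  have hB : ∀ y, |f y| ≤ 1 := fun y => by
    simp only [hfdef]; split_ifs <;> simp
  have hgen : ∀ y, 0 ≤ generator θ (i + k + 1) f y := fun y => by
    refine Finset.sum_nonneg fun a _ => Finset.sum_nonneg fun b _ => ?_
    split_ifs
    · rfl
    · refine mul_nonneg (hθ _ _).1 (sub_nonneg.2 ?_)
      have := le_jump y a b i k
      simp only [hfdef]
      split_ifs <;> first | omega | norm_num
  set A : Set Ω := {ω | c ≤ (X s ω).1 i k} with hAdef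
  have hA : MeasurableSet[past X s] A :=
    ((measurable_apply i k).comp (measurable_past X le_rfl)) measurableSet_Ici
  have hA' : MeasurableSet A := past_le h.measurable s _ hA
  have hint := h.integrable_compensated hθ hf hB s t
  have hI : ∀ ω, 0 ≤ ∫ u in (s : ℝ)..(t : ℝ), generator θ (i + k + 1) f (X u.toNNReal ω).1 :=
    fun ω => intervalIntegral.integral_nonneg (mod_cast hst) fun _ _ => hgen _
  have hle : ∀ ω ∈ A, 0 ≤ - compensated θ (i + k + 1) f X s t ω := fun ω hω => by
    have h1 : f (X s ω).1 = 1 := if_pos hω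
    have h2 := (abs_le.1 (hB (X t ω).1)).2
    have h3 := hI ω
    unfold compensated
    linarith
  have hzero := h.setIntegral_compensated hθ hf hB hst hA
  have h0 : (fun ω => - compensated θ (i + k + 1) f X s t ω) =ᵐ[P.restrict A] 0 := by
    refine (integral_eq_zero_iff_of_nonneg_ae ?_ hint.neg.integrableOn).1 ?_
    · exact (ae_restrict_iff' hA').2 (Eventually.of_forall hle)
    · rw [integral_neg', hzero, neg_zero]
  have h0' := (ae_restrict_iff' hA').1 h0
  filter_upwards [h0'] with ω hω hc
  have h1 : f (X s ω).1 = 1 := if_pos hc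
  have h2 : - compensated θ (i + k + 1) f X s t ω = 0 := hω hc
  have h3 := hI ω
  unfold compensated at h2
  by_contra hlt
  have h4 : f (X t ω).1 = 0 := if_neg hlt
  linarith

theorem ae_monotone (h : IsPureBirth P θ x X) (hθ : ∀ a b, 0 ≤ θ a b ∧ θ a b ≤ C) :
    ∀ᵐ ω ∂P, ∀ i k, Monotone fun t => (X t ω).1 i k := by
  have h1 : ∀ᵐ ω ∂P, ∀ i k c n : ℕ, ∀ a b : ℕ, a ≤ b →
      c ≤ (X (a / (n + 1)) ω).1 i k → c ≤ (X (b / (n + 1)) ω).1 i k := by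
    simp only [ae_all_iff]
    intro i k c n a b hab
    exact h.ae_le_of_le hθ (by gcongr) i k c
  filter_upwards [h1, h.rightContinuous] with ω hω hr i k s t hst
  have hs := (tendsto_gridTime s).eventually (eventually_agreeBelow (hr s) (i + k + 1))
  have ht := (tendsto_gridTime t).eventually (eventually_agreeBelow (hr t) (i + k + 1))
  -- One mesh serves both times, so the countably many comparisons along grids suffice.
  obtain ⟨n, hn1, hn2⟩ := (hs.and ht).exists
  have e1 : (X (gridTime n s) ω).1 i k = (X s ω).1 i k := hn1 i k (by omega)
  have e2 : (X (gridTime n t) ω).1 i k = (X t ω).1 i k := hn2 i k (by omega)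
  have h2 := hω i k _ n (⌊((n : NNReal) + 1) * s⌋₊ + 1) (⌊((n : NNReal) + 1) * t⌋₊ + 1)
    (by gcongr) le_rfl
  push_cast at h2
  change (X (gridTime n s) ω).1 i k ≤ (X (gridTime n t) ω).1 i k at h2
  simp only
  omega

/-- The first particle of the conjugate column `i`, truncated at `M`, measures the length of column
`i` up to `M`. It moves by at most one per jump, so its mean grows at a rate bounded by `D`
independently of `M`. On the event that the column is never packed it is at least `M`, and Markov's
inequality leaves probability zero. -/
theorem ae_star_at (h : IsPureBirth P θ x X) (hs : IsStar x.1)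
    (hθ : ∀ a b, 0 ≤ θ a b ∧ θ a b ≤ C) (t : NNReal) : ∀ᵐ ω ∂P, IsStar (X t ω).1 := by
  have hθ' : ∀ a b, 0 ≤ transposeEnv θ a b ∧ transposeEnv θ a b ≤ C := fun a b => hθ b a
  suffices hcol : ∀ i, ∀ᵐ ω ∂P, ∃ k, (X t ω).1 i k ≤ i by
    filter_upwards [ae_all_iff.2 hcol] with ω hω i _
    obtain ⟨k, hk⟩ := hω i
    exact ⟨k, fun m hm => le_antisymm (((X t ω).2.antitone i hm).trans hk)
      ((X t ω).2.le_apply i m)⟩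
  intro i
  set f : (ℕ → ℕ → ℕ) → ℝ := fun y => (y i 0 : ℝ) with hfdef
  have hf : ∀ y z, AgreeBelow (i + 1) y z → f y = f z := fun y z hyz => by
    simp only [hfdef, hyz i 0 (by omega)]
  set D : ℝ := (i + 1 : ℕ) * ((i + 1 : ℕ) * (C * 1)) with hD
  obtain ⟨K, hK⟩ := truncatedHgt_eventually_agree x.2 hs (i + 1)
  set A : Set Ω := {ω | ∀ k, i < (X t ω).1 i k} with hA
  have hAm : MeasurableSet A := by
    have : A = ⋂ k, {ω | i < (X t ω).1 i k} := by ext; simp [hA]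
    rw [this]
    exact .iInter fun k => ((measurable_apply i k).comp (h.measurable t)) measurableSet_Ioi
  set E : ℝ := hgtFun x.1 i 0 + D * t with hE
  have key : ∀ M, K ≤ M → P.real A * M ≤ E := by
    intro M hM
    set g : (ℕ → ℕ → ℕ) → ℝ := fun y => f (truncatedHgt M y) with hg
    have hgl : ∀ y z, AgreeBelow (i + 1 + M) y z → g y = g z := fun y z hyz =>
      hf _ _ (truncatedHgt_agreeBelow hyz)
    have hgB : ∀ y, |g y| ≤ i + M := fun y => by
      have h1 : height (truncate M y) i (i + 0) ≤ M := by
        refine (Set.ncard_le_ncard (t := Set.Iio M) (fun m hm => ?_) (Set.finite_Iio M)).trans ?_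
        · by_contra hlt
          simp only [Set.mem_ofPred_eq, truncate_of_le y i (not_lt.1 hlt)] at hm
          omega
        · rw [Set.ncard_eq_toFinset_card']; simp
      simp only [hg, hfdef, truncatedHgt, hgtFun, Nat.abs_cast]
      have h2 : height (truncate M y) i (i + 0) + i ≤ i + M := by omega
      exact_mod_cast h2
    have hI : ∀ ω, ∫ u in ((0 : NNReal) : ℝ)..(t : ℝ),
        generator θ (i + 1 + M) g (X u.toNNReal ω).1 ≤ D * t := fun ω => by
      refine (Real.le_norm_self _).trans ((intervalIntegral.norm_integral_le_of_norm_le_const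
        (C := D) fun u _ => ?_).trans ?_)
      · rw [hg, generator_truncatedHgt θ (i + 1) M hf (X u.toNNReal ω).2]
        refine abs_truncatedGenerator_le hθ' _ _ _ fun a b => ?_
        have h1 := le_jump (truncatedHgt M (X u.toNNReal ω).1) a b i 0
        have h2 := jump_le (truncatedHgt M (X u.toNNReal ω).1) a b i 0
        simp only [hfdef]
        rw [abs_le]
        constructor
        · rw [neg_le_sub_iff_le_add]; exact_mod_cast (by omega)
        · rw [sub_le_iff_le_add]; exact_mod_cast (by omega)
      · simp
    have hzero := h.setIntegral_compensated hθ hgl hgB (zero_le : (0 : NNReal) ≤ t)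
      MeasurableSet.univ
    rw [setIntegral_univ] at hzero
    have hmean : ∫ ω, g (X t ω).1 ∂P ≤ E := by
      have h1 : ∀ᵐ ω ∂P, g (X t ω).1 ≤ compensated θ (i + 1 + M) g X 0 t ω + E := by
        filter_upwards [h.initial] with ω hω
        have h2 := hI ω
        have h3 : g (X 0 ω).1 = hgtFun x.1 i 0 := by
          simp only [hω, hg, hfdef, hK M hM i (by omega)]
        simp only [compensated, hE]
        linarith
      have h2 := integral_mono_ae (h.integrable_apply hgl hgB t)
        ((h.integrable_compensated hθ hgl hgB 0 t).add (integrable_const E)) h1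
      refine h2.trans (le_of_eq ?_)
      simp only [Pi.add_apply]
      rw [integral_add (h.integrable_compensated hθ hgl hgB 0 t) (integrable_const E), hzero]
      simp
    have hmarkov : P.real A * M ≤ ∫ ω, g (X t ω).1 ∂P := by
      rw [mul_comm]
      refine le_trans ?_ (mul_meas_ge_le_integral_of_nonneg
        (Eventually.of_forall fun ω => Nat.cast_nonneg _) (h.integrable_apply hgl hgB t) M)
      refine mul_le_mul_of_nonneg_left (measureReal_mono fun ω hω => ?_) (Nat.cast_nonneg M)
      have hω' : ∀ k, i < (X t ω).1 i k := hω
      rcases Nat.eq_zero_or_pos M with rfl | hpos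
      · change ((0 : ℕ) : ℝ) ≤ ((truncatedHgt 0 (X t ω).1 i 0 : ℕ) : ℝ)
        exact_mod_cast Nat.zero_le _
      -- On `A` the box `(M - 1, 0)` survives the truncation, so the first conjugate particle is at
      -- `i + M` or beyond.
      · have h1 := (add_lt_hgtFun_iff (truncate_interlacing (X t ω).2 M)
          (truncate_star M (X t ω).1) i (M - 1) 0).2
          (by rw [truncate_of_lt _ _ (by omega)]; simpa using hω' (M - 1))
        change (M : ℝ) ≤ ((hgtFun (truncate M (X t ω).1) i 0 : ℕ) : ℝ)
        exact_mod_cast (by omega)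
    exact hmarkov.trans hmean
  have hA0 : P.real A = 0 := by
    by_contra hne
    have hpos : 0 < P.real A := lt_of_le_of_ne measureReal_nonneg (Ne.symm hne)
    obtain ⟨M, hM⟩ := exists_nat_gt (E / P.real A)
    have h1 := key (max K M) (le_max_left _ _)
    have h2 : (M : ℝ) ≤ (max K M : ℕ) := by exact_mod_cast le_max_right _ _
    rw [div_lt_iff₀ hpos] at hM
    nlinarith
  have hA1 : P A = 0 := (measureReal_eq_zero_iff).1 hA0
  filter_upwards [measure_eq_zero_iff_ae_notMem.1 hA1] with ω hω
  simpa [hA] using hω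

/-- By monotonicity, a column packed from row `K` on at an integer time was so at all earlier times.
-/
theorem ae_star (h : IsPureBirth P θ x X) (hs : IsStar x.1)
    (hθ : ∀ a b, 0 ≤ θ a b ∧ θ a b ≤ C) : ∀ᵐ ω ∂P, ∀ t, IsStar (X t ω).1 := by
  filter_upwards [h.ae_monotone hθ, ae_all_iff.2 fun n : ℕ => h.ae_star_at hs hθ n]
    with ω hmono hω t i hi
  obtain ⟨K, hK⟩ := hω ⌈t⌉₊ i hi
  refine ⟨K, fun k hk => le_antisymm ?_ ((X t ω).2.le_apply i k)⟩
  exact (hmono i k (Nat.le_ceil t)).trans (hK k hk).le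

theorem hgtExt (h : IsPureBirth P θ x X) (hs : IsStar x.1)
    (hθ : ∀ a b, 0 ≤ θ a b ∧ θ a b ≤ C) :
    IsPureBirth P (transposeEnv θ) (HgtExt x) fun t ω => HgtExt (X t ω) where
  measurable t := measurable_HgtExt.comp (h.measurable t)
  initial := h.initial.mono fun ω hω => by rw [hω]
  rightContinuous := by
    filter_upwards [h.ae_star hs hθ, h.ae_monotone hθ, h.rightContinuous] with ω hstar hmono hr t
    refine continuousWithinAt_of_eventually fun i l => ?_
    -- A conjugate column depends on infinitely many particles. Those in rows `k ≥ K` are packed at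
    -- time `t + 1`, so by monotonicity they have not moved since `t`; finitely many remain.
    obtain ⟨K, hK⟩ := eventually_packed (X (t + 1) ω).2 (hstar (t + 1)) i
    have h1 : ∀ᶠ s in 𝓝[Set.Ici t] t, s ≤ t + 1 :=
      mem_nhdsWithin_of_mem_nhds (Iic_mem_nhds (by simp))
    filter_upwards [h1, eventually_agreeBelow (hr t) (i + K), self_mem_nhdsWithin] with s hs1 hs2 hs3
    rw [HgtExt_of_star (hstar s), HgtExt_of_star (hstar t)]
    refine hgtFun_congr_column (funext fun k => ?_) l
    rcases Nat.lt_or_ge k K with hk | hk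
    · exact hs2 i k (by omega)
    · have e := hK k hk
      have e1 : (X s ω).1 i k ≤ (X (t + 1) ω).1 i k := hmono i k hs1
      have e2 : (X t ω).1 i k ≤ (X (t + 1) ω).1 i k := hmono i k le_self_add
      have e3 := (X s ω).2.le_apply i k
      have e4 := (X t ω).2.le_apply i k
      omega
  martingale := by
    rintro N f hf ⟨B, hB⟩ s t hst
    have hθ' : ∀ a b, 0 ≤ transposeEnv θ a b ∧ transposeEnv θ a b ≤ C := fun a b => hθ b a
    set D : ℝ := N * (N * (C * (2 * B))) with hD
    set Z : Ω → ℝ := compensated (transposeEnv θ) N f (fun t ω => HgtExt (X t ω)) s t with hZ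
    set g : ℕ → (ℕ → ℕ → ℕ) → ℝ := fun M y => f (truncatedHgt M y) with hg
    have hgl : ∀ M y z, AgreeBelow (N + M) y z → g M y = g M z := fun M y z hyz =>
      hf _ _ (truncatedHgt_agreeBelow hyz)
    have hgB : ∀ M y, |g M y| ≤ B := fun M y => hB _
    have hgen : ∀ M (y : IA), |generator θ (N + M) (g M) y.1| ≤ D := fun M y => by
      rw [hg, generator_truncatedHgt θ N M hf y.2]
      exact abs_truncatedGenerator_le hθ' _ _ _ fun _ _ => abs_sub_le_of_abs_le hB _ _
    have hlim : ∀ᵐ ω ∂P, Tendsto (fun M => compensated θ (N + M) (g M) X s t ω) atTop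
        (𝓝 (Z ω)) := by
      filter_upwards [h.ae_star hs hθ, h.rightContinuous] with ω hstar hr
      have h1 : ∀ u, Tendsto (fun M => g M (X u ω).1) atTop (𝓝 (f (HgtExt (X u ω)).1)) := by
        intro u
        obtain ⟨K, hK⟩ := truncatedHgt_eventually_agree (X u ω).2 (hstar u) N
        refine tendsto_const_nhds.congr' ?_
        filter_upwards [eventually_ge_atTop K] with M hM
        rw [HgtExt_of_star (hstar u)]
        exact (hf _ _ fun a b hab => by rw [hK M hM a (by omega)]).symm
      refine ((h1 t).sub (h1 s)).sub ?_
      refine intervalIntegral.tendsto_integral_filter_of_dominated_convergence (fun _ => D)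
        ?_ ?_ (by simp) ?_
      · exact Eventually.of_forall fun M => (measurable_path
          (fun _ _ => generator_congr θ (N + M) (hgl M)) hr).aestronglyMeasurable
      · exact Eventually.of_forall fun M => Eventually.of_forall fun u _ => hgen M _
      · refine Eventually.of_forall fun u _ => ?_
        obtain ⟨K, hK⟩ := truncatedGenerator_eventually_eq (transposeEnv θ) N hf
          (X u.toNNReal ω).2 (hstar u.toNNReal)
        refine tendsto_const_nhds.congr' ?_
        filter_upwards [eventually_ge_atTop K] with M hM
        rw [HgtExt_of_star (hstar _), hg, generator_truncatedHgt θ N M hf (X u.toNNReal ω).2,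
          hK M hM]
    have hbound : ∀ M, ∀ᵐ ω ∂P, ‖compensated θ (N + M) (g M) X s t ω‖ ≤
        2 * B + D * |(t : ℝ) - s| := fun M => Eventually.of_forall fun ω => by
      refine (norm_sub_le _ _).trans (add_le_add (abs_sub_le_of_abs_le (hgB M) _ _) ?_)
      exact intervalIntegral.norm_integral_le_of_norm_le_const fun u _ => hgen M _
    have h1 : P[Z | past X s] =ᵐ[P] P[(0 : Ω → ℝ) | past X s] := by
      refine tendsto_condExp_unique (fun M => compensated θ (N + M) (g M) X s t) (fun _ => 0) Z 0
        (fun M => h.integrable_compensated hθ (hgl M) (hgB M) s t) (fun _ => integrable_zero _ _ _)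
        hlim (Eventually.of_forall fun _ => tendsto_const_nhds) _ (integrable_const _)
        (fun _ => 0) (integrable_zero _ _ _) hbound (fun _ => Eventually.of_forall fun _ => by simp)
        fun M => ?_
      have h2 : P[compensated θ (N + M) (g M) X s t | past X s] =ᵐ[P] 0 :=
        h.martingale (N + M) (g M) (hgl M) ⟨B, hgB M⟩ s t hst
      rw [condExp_zero]
      exact h2
    rw [condExp_zero] at h1
    -- The conditional expectation vanishes given the past of `X`, hence also given the smaller past
    -- of the conjugate process.
    have h2 := condExp_condExp_of_le (μ := P) (f := Z) (past_comp_le X measurable_HgtExt s)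
      (past_le h.measurable s)
    have h3 := condExp_congr_ae (m := past (fun t ω => HgtExt (X t ω)) s) h1
    rw [condExp_zero] at h3
    exact h2.symm.trans h3

end IsPureBirth


/-! ### Sequential update rules -/

/-- The configuration `y` with its entry at `c` replaced by `v`. -/
def setAt (y : ℕ → ℕ → ℕ) (c : ℕ × ℕ) (v : ℕ) : ℕ → ℕ → ℕ := fun i k => if (i, k) = c then v else y i k

/-- Weights `q y i k` of the value `y i k`, given the values of `y` below and to the left, with
total mass at most `b (i, k)`. -/
structure IsUpdateRule (q : (ℕ → ℕ → ℕ) → ℕ → ℕ → ℝ) (b : ℕ × ℕ → ℝ) : Prop where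
  nonneg : ∀ y i k, 0 ≤ q y i k
  congr : ∀ y z i k, (∀ i' k', i' ≤ i → k' ≤ k → y i' k' = z i' k') → q y i k = q z i k
  sum_le : ∀ y i k (s : Finset ℕ), ∑ v ∈ s, q (setAt y (i, k) v) i k ≤ b (i, k)

theorem IsUpdateRule.mass_nonneg {q : (ℕ → ℕ → ℕ) → ℕ → ℕ → ℝ} {b : ℕ × ℕ → ℝ}
    (hq : IsUpdateRule q b) (c : ℕ × ℕ) : 0 ≤ b c := by
  simpa using hq.sum_le 0 c.1 c.2 ∅

theorem IsUpdateRule.prod_nonneg {q : (ℕ → ℕ → ℕ) → ℕ → ℕ → ℝ} {b : ℕ × ℕ → ℝ}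
    (hq : IsUpdateRule q b) (A : Finset (ℕ × ℕ)) (y : ℕ → ℕ → ℕ) : 0 ≤ ∏ c ∈ A, q y c.1 c.2 :=
  Finset.prod_nonneg fun _ _ => hq.nonneg _ _ _

/-- `y` and `z` coincide on `A`. -/
def AgreeOn (A : Finset (ℕ × ℕ)) (y z : ℕ → ℕ → ℕ) : Prop := ∀ c ∈ A, y c.1 c.2 = z c.1 c.2

theorem AgreeOn.prod_eq {q : (ℕ → ℕ → ℕ) → ℕ → ℕ → ℝ} {b : ℕ × ℕ → ℝ} (hq : IsUpdateRule q b)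
    {A : Finset (ℕ × ℕ)} (hA : IsLowerSet (A : Set (ℕ × ℕ))) {y z : ℕ → ℕ → ℕ}
    (h : AgreeOn A y z) : ∏ c ∈ A, q y c.1 c.2 = ∏ c ∈ A, q z c.1 c.2 :=
  Finset.prod_congr rfl fun c hc => hq.congr _ _ _ _ fun i' k' hi hk =>
    h (i', k') (hA (show ((i', k') : ℕ × ℕ) ≤ c from ⟨hi, hk⟩) hc)

/-- Marginalisation: the weights on `B` of distinct extensions of a configuration on `A`. -/
theorem sum_prod_le {q : (ℕ → ℕ → ℕ) → ℕ → ℕ → ℝ} {b : ℕ × ℕ → ℝ} (hq : IsUpdateRule q b)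
    {A B : Finset (ℕ × ℕ)} (hA : IsLowerSet (A : Set (ℕ × ℕ)))
    (hB : IsLowerSet (B : Set (ℕ × ℕ))) (hAB : A ⊆ B) (p : ℕ → ℕ → ℕ)
    (F : Finset (ℕ → ℕ → ℕ)) (hF : ∀ w ∈ F, AgreeOn A w p)
    (hinj : ∀ w ∈ F, ∀ w' ∈ F, AgreeOn B w w' → w = w') :
    ∑ w ∈ F, ∏ c ∈ B, q w c.1 c.2 ≤ (∏ c ∈ A, q p c.1 c.2) * ∏ c ∈ B \ A, b c := by
  classical
  induction hn : (B \ A).card generalizing B F with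
  | zero =>
    rw [Finset.card_eq_zero] at hn
    obtain rfl : A = B := hAB.antisymm (Finset.sdiff_eq_empty_iff_subset.1 hn)
    rw [hn, Finset.prod_empty, mul_one]
    have h1 : F.card ≤ 1 := Finset.card_le_one.2 fun w hw w' hw' =>
      hinj w hw w' hw' fun c hc => (hF w hw c hc).trans (hF w' hw' c hc).symm
    rcases Nat.le_one_iff_eq_zero_or_eq_one.1 h1 with h | h
    · rw [Finset.card_eq_zero.1 h, Finset.sum_empty]
      exact hq.prod_nonneg _ _
    · obtain ⟨w, rfl⟩ := Finset.card_eq_one.1 h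
      rw [Finset.sum_singleton]
      exact ((hF w (by simp)).prod_eq hq hA).le
  | succ n ih =>
    -- A coordinate of maximal level can be summed out first: no other weight depends on it, and
    -- removing it leaves a lower set.
    obtain ⟨c, hc, hmax⟩ := Finset.exists_max_image (B \ A) (fun c => c.1 + c.2)
      (Finset.card_pos.1 (by omega))
    rw [Finset.mem_sdiff] at hc
    have hB' : IsLowerSet ((B.erase c : Finset (ℕ × ℕ)) : Set (ℕ × ℕ)) := by
      intro d e hed hd
      simp only [Finset.coe_erase, Set.mem_sdiff, Finset.mem_coe, Set.mem_singleton_iff] at hd ⊢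
      refine ⟨hB hed hd.1, ?_⟩
      rintro rfl
      have hdA : d ∉ A := fun h => hc.2 (hA hed h)
      have h1 := hmax d (Finset.mem_sdiff.2 ⟨hd.1, hdA⟩)
      have h2 := hed.1
      have h3 := hed.2
      exact hd.2 (Prod.ext (by omega) (by omega))
    have hAB' : A ⊆ B.erase c := fun a ha =>
      Finset.mem_erase.2 ⟨fun h => hc.2 (h ▸ ha), hAB ha⟩
    have hcard : ((B.erase c) \ A).card = n := by
      rw [Finset.erase_sdiff_comm, Finset.card_erase_of_mem (Finset.mem_sdiff.2 hc)]
      omega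
    -- `r` forgets the values outside `B.erase c`, so on `B` the members of a fibre differ only at
    -- `c`.
    set r : (ℕ → ℕ → ℕ) → (ℕ → ℕ → ℕ) := fun w i k => if (i, k) ∈ B.erase c then w i k else 0 with hr
    have hrw : ∀ w, AgreeOn (B.erase c) (r w) w := fun w d hd => by simp only [hr]; exact if_pos hd
    have hsplit : ∀ w, ∏ d ∈ B, q w d.1 d.2 = q w c.1 c.2 * ∏ d ∈ B.erase c, q w d.1 d.2 :=
      fun w => (Finset.mul_prod_erase B (fun d => q w d.1 d.2) hc.1).symm
    have hfib : ∀ u, ∑ w ∈ F with r w = u, ∏ d ∈ B, q w d.1 d.2 ≤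
        b c * ∏ d ∈ B.erase c, q u d.1 d.2 := by
      intro u
      have h1 : ∀ w ∈ F.filter (r · = u), ∏ d ∈ B, q w d.1 d.2 =
          q (setAt u c (w c.1 c.2)) c.1 c.2 * ∏ d ∈ B.erase c, q u d.1 d.2 := by
        intro w hw
        obtain ⟨-, rfl⟩ := Finset.mem_filter.1 hw
        rw [hsplit, (hrw w).prod_eq hq hB']
        congr 1
        refine hq.congr _ _ _ _ fun i k hi hk => ?_
        by_cases hik : (i, k) = c
        · subst hik; simp [setAt]
        · simp only [setAt, hik, if_false]
          exact (hrw w (i, k) (Finset.mem_erase.2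
            ⟨hik, hB (show ((i, k) : ℕ × ℕ) ≤ c from ⟨hi, hk⟩) hc.1⟩)).symm
      rw [Finset.sum_congr rfl h1, ← Finset.sum_mul]
      refine mul_le_mul_of_nonneg_right ?_ (hq.prod_nonneg _ _)
      rw [← Finset.sum_image (f := fun v => q (setAt u c v) c.1 c.2)
        (g := fun w : ℕ → ℕ → ℕ => w c.1 c.2)]
      · exact hq.sum_le u c.1 c.2 _
      · intro w hw w' hw' e
        simp only [Finset.coe_filter, Set.mem_ofPred_eq] at hw hw'
        refine hinj w hw.1 w' hw'.1 fun d hd => ?_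
        by_cases hdc : d = c
        · subst hdc; exact e
        · have hd' := Finset.mem_erase.2 ⟨hdc, hd⟩
          rw [← hrw w d hd', ← hrw w' d hd', hw.2, hw'.2]
    calc ∑ w ∈ F, ∏ d ∈ B, q w d.1 d.2
        = ∑ u ∈ F.image r, ∑ w ∈ F with r w = u, ∏ d ∈ B, q w d.1 d.2 :=
          (Finset.sum_fiberwise_of_maps_to (fun w hw => Finset.mem_image_of_mem r hw) _).symm
      _ ≤ ∑ u ∈ F.image r, b c * ∏ d ∈ B.erase c, q u d.1 d.2 :=
          Finset.sum_le_sum fun u _ => hfib u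
      _ = b c * ∑ u ∈ F.image r, ∏ d ∈ B.erase c, q u d.1 d.2 := by rw [Finset.mul_sum]
      _ ≤ b c * ((∏ d ∈ A, q p d.1 d.2) * ∏ d ∈ B.erase c \ A, b d) := by
          refine mul_le_mul_of_nonneg_left (ih hB' hAB' _ ?_ ?_ hcard) (hq.mass_nonneg c)
          · intro u hu d hd
            obtain ⟨w, hw, rfl⟩ := Finset.mem_image.1 hu
            rw [hrw w d (hAB' hd), hF w hw d hd]
          · intro u hu u' hu' e
            obtain ⟨w, hw, rfl⟩ := Finset.mem_image.1 hu
            obtain ⟨w', hw', rfl⟩ := Finset.mem_image.1 hu'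
            funext i k
            by_cases hik : (i, k) ∈ B.erase c
            · exact e (i, k) hik
            · simp only [hr, hik, if_false]
      _ = (∏ d ∈ A, q p d.1 d.2) * ∏ d ∈ B \ A, b d := by
          rw [Finset.erase_sdiff_comm, ← Finset.mul_prod_erase (B \ A) b (Finset.mem_sdiff.2 hc)]
          ring

/-! ### Measures with given cylinder weights -/

/-- The coordinates on levels `0, …, N - 1`. -/
def triangle (N : ℕ) : Finset (ℕ × ℕ) := (Finset.range N ×ˢ Finset.range N).filter fun c => c.1 + c.2 < N

theorem mem_triangle {N : ℕ} {c : ℕ × ℕ} : c ∈ triangle N ↔ c.1 + c.2 < N := by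
  simp only [triangle, Finset.mem_filter, Finset.mem_product, Finset.mem_range]
  omega

theorem isLowerSet_triangle (N : ℕ) : IsLowerSet (triangle N : Set (ℕ × ℕ)) := by
  intro d e hed hd
  rw [Finset.mem_coe, mem_triangle] at hd ⊢
  have h1 := hed.1
  have h2 := hed.2
  omega

theorem isLowerSet_range_product (N M : ℕ) :
    IsLowerSet ((Finset.range N ×ˢ Finset.range M : Finset (ℕ × ℕ)) : Set (ℕ × ℕ)) := by
  intro d e hed hd
  simp only [Finset.coe_product, Finset.coe_range, Set.mem_prod, Set.mem_Iio] at hd ⊢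
  exact ⟨hed.1.trans_lt hd.1, hed.2.trans_lt hd.2⟩

theorem prod_triangle (N : ℕ) (g : ℕ → ℕ → ℝ) :
    ∏ c ∈ triangle N, g c.1 c.2 = ∏ i ∈ Finset.range N, ∏ k ∈ Finset.range (N - i), g i k := by
  rw [triangle, Finset.prod_filter, Finset.prod_product]
  refine Finset.prod_congr rfl fun i hi => ?_
  rw [← Finset.prod_filter]
  refine Finset.prod_congr ?_ fun _ _ => rfl
  ext k
  simp only [Finset.mem_filter, Finset.mem_range]
  omega

theorem agreeBelow_iff_agreeOn {N : ℕ} {y z : ℕ → ℕ → ℕ} :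
    AgreeBelow N y z ↔ AgreeOn (triangle N) y z :=
  ⟨fun h c hc => h c.1 c.2 (mem_triangle.1 hc), fun h i k hik => h (i, k) (mem_triangle.2 hik)⟩

theorem exists_subset_triangle (A : Finset (ℕ × ℕ)) : ∃ N, A ⊆ triangle N := by
  refine ⟨A.sup (fun c => c.1 + c.2) + 1, fun c hc => mem_triangle.2 ?_⟩
  exact Nat.lt_succ_of_le (Finset.le_sup (f := fun c : ℕ × ℕ => c.1 + c.2) hc)

theorem measureReal_le_of_cover {α ι : Type*} [MeasurableSpace α] [Countable ι] {ν : Measure α}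
    [IsFiniteMeasure ν] {E : Set α} {S : ι → Set α} (hcov : ν (E \ ⋃ i, S i) = 0) {R : ℝ}
    (hR : ∀ F : Finset ι, ∑ i ∈ F, ν.real (S i) ≤ R) : ν.real E ≤ R := by
  have hR0 : 0 ≤ R := by simpa using hR ∅
  have h1 : ν E ≤ ν (⋃ i, S i) := by
    refine (measure_mono (Set.subset_sdiff_union E (⋃ i, S i))).trans ((measure_union_le _ _).trans ?_)
    rw [hcov, zero_add]
  have h2 : ν E ≤ ENNReal.ofReal R := by
    refine h1.trans ((measure_iUnion_le S).trans ?_)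
    rw [ENNReal.tsum_eq_iSup_sum]
    refine iSup_le fun F => ?_
    have h3 : ∑ i ∈ F, ν (S i) = ENNReal.ofReal (∑ i ∈ F, ν.real (S i)) := by
      rw [ENNReal.ofReal_sum_of_nonneg fun _ _ => measureReal_nonneg]
      exact Finset.sum_congr rfl fun i _ => (ofReal_measureReal).symm
    rw [h3]
    exact ENNReal.ofReal_le_ofReal (hR F)
  exact ENNReal.toReal_le_of_le_ofReal hR0 h2

/-- There are countably many patterns on `B`, so their cylinders cover the event. The bound is asked
only for finite families, which avoids any question of summability. -/
theorem measureReal_le_of_patterns {ν : Measure IA} [IsFiniteMeasure ν] (B : Finset (ℕ × ℕ))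
    {Q : (ℕ → ℕ → ℕ) → Prop} (hQ : ∀ w w', AgreeOn B w w' → Q w → Q w') {R : ℝ}
    (hR : ∀ F : Finset (ℕ → ℕ → ℕ), (∀ w ∈ F, Q w) →
      (∀ w ∈ F, ∀ w' ∈ F, AgreeOn B w w' → w = w') →
      ∑ w ∈ F, ν.real {z | AgreeOn B z.1 w} ≤ R) :
    ν.real {z | Q z.1} ≤ R := by
  classical
  set e : (B → ℕ) → (ℕ → ℕ → ℕ) := fun p i k => if h : (i, k) ∈ B then p ⟨(i, k), h⟩ else 0 with he
  have heB : ∀ p (c : B), e p c.1.1 c.1.2 = p c := fun p c => by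
    simp only [he]; exact dif_pos c.2
  have hinj : ∀ p p', AgreeOn B (e p) (e p') → p = p' := fun p p' h => by
    funext c
    rw [← heB p c, ← heB p' c]
    exact h c.1 c.2
  refine measureReal_le_of_cover (ι := {p : B → ℕ // Q (e p)})
    (S := fun p => {z | AgreeOn B z.1 (e p.1)}) ?_ fun F => ?_
  · convert measure_empty (μ := ν)
    rw [Set.sdiff_eq_empty]
    intro z hz
    have h1 : AgreeOn B z.1 (e fun c => z.1 c.1.1 c.1.2) := fun c hc => 
      (heB (fun c => z.1 c.1.1 c.1.2) ⟨c, hc⟩).symm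
    exact Set.mem_iUnion.2 ⟨⟨fun c => z.1 c.1.1 c.1.2, hQ _ _ h1 hz⟩, h1⟩
  · rw [← Finset.sum_image (f := fun w => ν.real {z : IA | AgreeOn B z.1 w})
      (g := fun p : {p : B → ℕ // Q (e p)} => e p.1)]
    · refine hR _ (fun w hw => ?_) fun w hw w' hw' h => ?_
      · obtain ⟨p, -, rfl⟩ := Finset.mem_image.1 hw
        exact p.2
      · obtain ⟨p, -, rfl⟩ := Finset.mem_image.1 hw
        obtain ⟨p', -, rfl⟩ := Finset.mem_image.1 hw'
        rw [hinj _ _ h]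
    · intro p _ p' _ h
      refine Subtype.ext (hinj _ _ ?_)
      have h' : e p.1 = e p'.1 := h
      rw [h']
      exact fun _ _ => rfl

/-- The cylinder weights of `ν` are the products of `q`. -/
def HasWeights (ν : Measure IA) (q : (ℕ → ℕ → ℕ) → ℕ → ℕ → ℝ) : Prop :=
  ∀ N y, ν.real {z | AgreeBelow N z.1 y} = ∏ c ∈ triangle N, q y c.1 c.2

theorem HasWeights.measureReal_le {ν : Measure IA} [IsFiniteMeasure ν]
    {q : (ℕ → ℕ → ℕ) → ℕ → ℕ → ℝ} (h : HasWeights ν q) (N : ℕ)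
    {Q : (ℕ → ℕ → ℕ) → Prop} (hQ : ∀ w w', AgreeBelow N w w' → Q w → Q w') {R : ℝ}
    (hR : ∀ F : Finset (ℕ → ℕ → ℕ), (∀ w ∈ F, Q w) →
      (∀ w ∈ F, ∀ w' ∈ F, AgreeOn (triangle N) w w' → w = w') →
      ∑ w ∈ F, ∏ c ∈ triangle N, q w c.1 c.2 ≤ R) :
    ν.real {z | Q z.1} ≤ R := by
  refine measureReal_le_of_patterns (triangle N) (fun w w' hw => hQ w w' (agreeBelow_iff_agreeOn.2 hw))
    fun F h1 h2 => ?_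
  refine le_trans (le_of_eq ?_) (hR F h1 h2)
  refine Finset.sum_congr rfl fun w _ => ?_
  simp only [← h N w, agreeBelow_iff_agreeOn]

theorem HasWeights.measureReal_agreeOn_le {ν : Measure IA} [IsFiniteMeasure ν]
    {q : (ℕ → ℕ → ℕ) → ℕ → ℕ → ℝ} (h : HasWeights ν q) (hq : IsUpdateRule q fun _ => 1)
    {A : Finset (ℕ × ℕ)} (hA : IsLowerSet (A : Set (ℕ × ℕ))) (p : ℕ → ℕ → ℕ) :
    ν.real {z | AgreeOn A z.1 p} ≤ ∏ c ∈ A, q p c.1 c.2 := by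
  obtain ⟨N, hN⟩ := exists_subset_triangle A
  refine h.measureReal_le N (Q := fun w => AgreeOn A w p) ?_ fun F h1 h2 => ?_
  · intro w w' hw hp c hc
    rw [← agreeBelow_iff_agreeOn.1 hw c (hN hc), hp c hc]
  · simpa using sum_prod_le hq hA (isLowerSet_triangle N) hN p F h1 h2


/-! ### Weights of the conjugate of a random array -/

theorem exists_columnCode {z : ℕ → ℕ → ℕ} (hz : IsInterlacing z) (hs : IsStar z) (N : ℕ) :
    ∃ c : ℕ × ℕ →₀ ℕ, (∀ i k, i < N → z i k = c (i, k) + i) ∧ ∀ i k, N ≤ i → c (i, k) = 0 := by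
  choose K hK using eventually_packed hz hs
  have hfin : (Function.support fun c : ℕ × ℕ => if c.1 < N then z c.1 c.2 - c.1 else 0).Finite := by
    refine (Finset.finite_toSet (Finset.range N ×ˢ Finset.range ((Finset.range N).sup K))).subset ?_
    rintro ⟨i, k⟩ hik
    simp only [Function.mem_support, ne_eq, ite_eq_right_iff, Classical.not_imp] at hik
    simp only [Finset.coe_product, Finset.coe_range, Set.mem_prod, Set.mem_Iio]
    refine ⟨hik.1, ?_⟩
    by_contra hlt
    have h1 : K i ≤ (Finset.range N).sup K := Finset.le_sup (Finset.mem_range.2 hik.1)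
    have := hK i k (by omega)
    omega
  refine ⟨Finsupp.ofSupportFinite _ hfin, fun i k hi => ?_, fun i k hi => ?_⟩
  · have := hz.le_apply i k
    rw [Finsupp.ofSupportFinite_coe]
    simp only [hi, if_true]
    omega
  · rw [Finsupp.ofSupportFinite_coe]
    simp only [not_lt.2 hi, if_false]

/-- If the columns of `z` and of its conjugate have the same weights, the conjugate of a random
array with weights `q` has weights at most `q'`. -/
theorem HasWeights.measureReal_hgtExt_le {ν : Measure IA} [IsFiniteMeasure ν]
    {q q' : (ℕ → ℕ → ℕ) → ℕ → ℕ → ℝ} (h : HasWeights ν q)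
    (hq : IsUpdateRule q fun _ => 1) (hq' : IsUpdateRule q' fun _ => 1)
    (hstar : ∀ᵐ z ∂ν, IsStar z.1)
    (hcol : ∀ z : ℕ → ℕ → ℕ, IsInterlacing z → IsStar z → ∀ i, ∃ K, ∀ M, K ≤ M →
      ∏ k ∈ Finset.range M, q z i k = ∏ l ∈ Finset.range M, q' (hgtFun z) i l)
    (N : ℕ) (p : ℕ → ℕ → ℕ) :
    ν.real {z | AgreeBelow N (HgtExt z).1 p} ≤ ∏ c ∈ triangle N, q' p c.1 c.2 := by
  classical
  -- Finitely supported codes form a countable type, so the possible first `N` columns of starred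
  -- arrays give a countable cover.
  set T : Set (ℕ × ℕ →₀ ℕ) := {c | ∃ z : ℕ → ℕ → ℕ, (IsInterlacing z ∧ IsStar z) ∧
    AgreeBelow N (hgtFun z) p ∧ (∀ i k, i < N → z i k = c (i, k) + i) ∧
      ∀ i k, N ≤ i → c (i, k) = 0} with hT
  have hex : ∀ c : T, ∃ z : ℕ → ℕ → ℕ, (IsInterlacing z ∧ IsStar z) ∧
    AgreeBelow N (hgtFun z) p ∧ (∀ i k, i < N → z i k = c.1 (i, k) + i) ∧
      ∀ i k, N ≤ i → c.1 (i, k) = 0 := fun c => c.2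
  choose Z hZ hZp hZc hZ0 using hex
  refine measureReal_le_of_cover (ι := T) (S := fun c => {z | ∀ i, i < N → z.1 i = Z c i}) ?_ ?_
  · refine measure_mono_null ?_ hstar
    rintro z ⟨hz, hzS⟩ hs
    refine hzS (Set.mem_iUnion.2 ?_)
    obtain ⟨c, hc1, hc2⟩ := exists_columnCode z.2 hs N
    have hz' : AgreeBelow N (hgtFun z.1) p := by
      rw [← HgtExt_of_star hs]; exact hz
    refine ⟨⟨c, z.1, ⟨z.2, hs⟩, hz', hc1, hc2⟩, fun i hi => funext fun k => ?_⟩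
    rw [hc1 i k hi, hZc _ i k hi]
  · intro F
    have hcol' : ∀ (c : T) (i : ℕ), ∃ K, ∀ M, K ≤ M →
        (∏ k ∈ Finset.range M, q (Z c) i k = ∏ l ∈ Finset.range M, q' (hgtFun (Z c)) i l) ∧
          ∀ l, M ≤ l → hgtFun (Z c) i l = i := by
      intro c i
      obtain ⟨K, hK⟩ := hcol (Z c) (hZ c).1 (hZ c).2 i
      obtain ⟨K', hK'⟩ := eventually_packed (hgtFun_interlacing (hZ c).1 (hZ c).2)
        (hgtFun_star (hZ c).1) i
      exact ⟨max K K', fun M hM => ⟨hK M (le_of_max_le_left hM), fun l hl =>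
        hK' l ((le_of_max_le_right hM).trans hl)⟩⟩
    choose K hK using hcol'
    -- For the finitely many codes in `F`, `M` is large enough for the column identities to hold and
    -- for the conjugate columns to be packed from row `M` on. `N ≤ M` puts the triangle inside the
    -- rectangle `R`.
    set M : ℕ := max N (F.sup fun c => (Finset.range N).sup (K c)) with hM
    have hKM : ∀ c ∈ F, ∀ i, i < N → K c i ≤ M := fun c hc i hi =>
      ((Finset.le_sup (f := K c) (Finset.mem_range.2 hi)).trans
        (Finset.le_sup (f := fun c => (Finset.range N).sup (K c)) hc)).trans (le_max_right _ _)
    set R : Finset (ℕ × ℕ) := Finset.range N ×ˢ Finset.range M with hR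
    have hRl : IsLowerSet (R : Set (ℕ × ℕ)) := isLowerSet_range_product N M
    have hdist : ∀ c ∈ F, ∀ c' ∈ F, AgreeOn R (hgtFun (Z c)) (hgtFun (Z c')) → c = c' := by
      intro c hc c' hc' hag
      have h1 : ∀ i, i < N → hgtFun (Z c) i = hgtFun (Z c') i := fun i hi => funext fun l => by
        rcases Nat.lt_or_ge l M with hl | hl
        · exact hag (i, l) (Finset.mem_product.2 ⟨Finset.mem_range.2 hi, Finset.mem_range.2 hl⟩)
        · rw [(hK c i M (hKM c hc i hi)).2 l hl, (hK c' i M (hKM c' hc' i hi)).2 l hl]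
      refine Subtype.ext (Finsupp.ext fun d => ?_)
      obtain ⟨i, k⟩ := d
      rcases Nat.lt_or_ge i N with hi | hi
      · have h2 := hgtFun_congr_column (h1 i hi) k
        rw [hgtFun_hgtFun (hZ c).1 (hZ c).2, hgtFun_hgtFun (hZ c').1 (hZ c').2, hZc c i k hi,
          hZc c' i k hi] at h2
        omega
      · rw [hZ0 c i k hi, hZ0 c' i k hi]
    calc ∑ c ∈ F, ν.real {z | ∀ i, i < N → z.1 i = Z c i}
        ≤ ∑ c ∈ F, ∏ d ∈ R, q' (hgtFun (Z c)) d.1 d.2 := by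
          refine Finset.sum_le_sum fun c hc => ?_
          have h1 : ν.real {z | ∀ i, i < N → z.1 i = Z c i} ≤ ν.real {z | AgreeOn R z.1 (Z c)} := by
            refine measureReal_mono fun z hz d hd => ?_
            rw [hz d.1 (Finset.mem_range.1 (Finset.mem_product.1 hd).1)]
          refine (h1.trans (h.measureReal_agreeOn_le hq hRl (Z c))).trans (le_of_eq ?_)
          rw [hR, Finset.prod_product, Finset.prod_product]
          exact Finset.prod_congr rfl fun i hi =>
            (hK c i M (hKM c hc i (Finset.mem_range.1 hi))).1
      _ = ∑ w ∈ F.image fun c => hgtFun (Z c), ∏ d ∈ R, q' w d.1 d.2 := by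
          rw [Finset.sum_image]
          intro c hc c' hc' e
          have e' : hgtFun (Z c) = hgtFun (Z c') := e
          exact hdist c hc c' hc' fun _ _ => by rw [e']
      _ ≤ ∏ c ∈ triangle N, q' p c.1 c.2 := by
          refine (sum_prod_le hq' (isLowerSet_triangle N) hRl (fun c hc => ?_) p _ ?_ ?_).trans
            (le_of_eq (by simp))
          · have := mem_triangle.1 hc
            have h3 : N ≤ M := le_max_left _ _
            exact Finset.mem_product.2 ⟨Finset.mem_range.2 (by omega), Finset.mem_range.2 (by omega)⟩
          · intro w hw
            obtain ⟨c, -, rfl⟩ := Finset.mem_image.1 hw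
            exact agreeBelow_iff_agreeOn.1 (hZp c)
          · intro w hw w' hw' e
            obtain ⟨c, hc, rfl⟩ := Finset.mem_image.1 hw
            obtain ⟨c', hc', rfl⟩ := Finset.mem_image.1 hw'
            rw [hdist c hc c' hc' e]

/-- A probability measure whose cylinder weights are at most those of an update rule has exactly
these weights. -/
theorem hasWeights_of_le {ν : Measure IA} [IsProbabilityMeasure ν]
    {q : (ℕ → ℕ → ℕ) → ℕ → ℕ → ℝ} (hq : IsUpdateRule q fun _ => 1)
    (h : ∀ N y, ν.real {z | AgreeBelow N z.1 y} ≤ ∏ c ∈ triangle N, q y c.1 c.2) :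
    HasWeights ν q := by
  classical
  intro N p
  refine le_antisymm (h N p) ?_
  -- The weights of all patterns sum to at most one, so the patterns other than `p` carry at most
  -- the complementary mass.
  have h1 : ν.real {z | ¬ AgreeBelow N z.1 p} ≤ 1 - ∏ c ∈ triangle N, q p c.1 c.2 := by
    refine measureReal_le_of_patterns (triangle N) (Q := fun w => ¬ AgreeBelow N w p) ?_ ?_
    · intro w w' hw hp hp'
      exact hp (agreeBelow_iff_agreeOn.2 fun c hc => (hw c hc).trans (agreeBelow_iff_agreeOn.1 hp' c hc))
    · intro F hF hinj
      have hp : p ∉ F := fun hp => hF p hp fun _ _ _ => rfl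
      have h2 : ∑ w ∈ insert p F, ∏ c ∈ triangle N, q w c.1 c.2 ≤ 1 := by
        have := sum_prod_le hq (A := ∅) (by simp [IsLowerSet]) (isLowerSet_triangle N)
          (Finset.empty_subset _) p (insert p F) (fun _ _ c hc => absurd hc (by simp)) ?_
        · simpa using this
        · intro w hw w' hw' e
          rcases Finset.mem_insert.1 hw with rfl | h1 <;> rcases Finset.mem_insert.1 hw' with rfl | h2
          · rfl
          · exact absurd (agreeBelow_iff_agreeOn.2 fun c hc => (e c hc).symm) (hF w' h2)
          · exact absurd (agreeBelow_iff_agreeOn.2 e) (hF w h1)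
          · exact hinj w h1 w' h2 e
      rw [Finset.sum_insert hp] at h2
      have h3 : ∑ w ∈ F, ν.real {z | AgreeOn (triangle N) z.1 w} ≤
          ∑ w ∈ F, ∏ c ∈ triangle N, q w c.1 c.2 := by
        refine Finset.sum_le_sum fun w _ => ?_
        simpa only [agreeBelow_iff_agreeOn] using h N w
      linarith
  have h2 : ν.real {z | ¬ AgreeBelow N z.1 p} = 1 - ν.real {z | AgreeBelow N z.1 p} :=
    probReal_compl_eq_one_sub (measurableSet_agreeBelow N p)
  linarith

theorem HasWeights.map_hgtExt {ν : Measure IA} [IsProbabilityMeasure ν]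
    {q q' : (ℕ → ℕ → ℕ) → ℕ → ℕ → ℝ} (h : HasWeights ν q)
    (hq : IsUpdateRule q fun _ => 1) (hq' : IsUpdateRule q' fun _ => 1)
    (hstar : ∀ᵐ z ∂ν, IsStar z.1)
    (hcol : ∀ z : ℕ → ℕ → ℕ, IsInterlacing z → IsStar z → ∀ i, ∃ K, ∀ M, K ≤ M →
      ∏ k ∈ Finset.range M, q z i k = ∏ l ∈ Finset.range M, q' (hgtFun z) i l) :
    HasWeights (ν.map HgtExt) q' := by
  have := Measure.isProbabilityMeasure_map (μ := ν) measurable_HgtExt.aemeasurable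
  refine hasWeights_of_le hq' fun N p => ?_
  rw [map_measureReal_apply measurable_HgtExt (measurableSet_agreeBelow N p)]
  exact h.measureReal_hgtExt_le hq hq' hstar hcol N p


/-! ### The inhomogeneous geometric distribution -/

theorem geomProb_nonneg {θ : ℕ → ℕ → ℝ} {C : ℝ} (hC : C < 1)
    (hθ : ∀ a b, 0 ≤ θ a b ∧ θ a b ≤ C) (n z w : ℕ) : 0 ≤ geomProb θ n z w := by
  unfold geomProb
  split_ifs
  · exact mul_nonneg (Finset.prod_nonneg fun _ _ => (hθ _ _).1) (by linarith [(hθ w n).2])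
  · rfl

/-- The sum telescopes: `m` terms give the product up to `b` minus the product up to `b + m`, and
the latter is at most `C ^ m`. -/
theorem hasSum_geomProb_tail {θ : ℕ → ℕ → ℝ} {C : ℝ} (hC : C < 1)
    (hθ : ∀ a b, 0 ≤ θ a b ∧ θ a b ≤ C) (n : ℕ) {z b : ℕ} (hzb : z ≤ b) :
    HasSum (fun w => if b ≤ w then geomProb θ n z w else 0) (∏ l ∈ Finset.Ico z b, θ l n) := by
  have hC0 : 0 ≤ C := (hθ 0 0).1.trans (hθ 0 0).2
  have h1 : HasSum (fun j => geomProb θ n z (j + b)) (∏ l ∈ Finset.Ico z b, θ l n) := by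
    rw [hasSum_iff_tendsto_nat_of_nonneg fun j => geomProb_nonneg hC hθ n z _]
    have hpart : ∀ m, ∑ j ∈ Finset.range m, geomProb θ n z (j + b) =
        ∏ l ∈ Finset.Ico z b, θ l n - ∏ l ∈ Finset.Ico z (b + m), θ l n := by
      intro m
      induction m with
      | zero => simp
      | succ m ih =>
        rw [Finset.sum_range_succ, ih, geomProb, if_pos (by omega), ← add_assoc,
          Finset.prod_Ico_succ_top (by omega), add_comm m b]
        ring
    have hle : ∀ m, ∏ l ∈ Finset.Ico z (b + m), θ l n ≤ C ^ m := by
      intro m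
      rw [← Finset.prod_Ico_consecutive _ hzb (Nat.le_add_right b m)]
      refine (mul_le_mul (Finset.prod_le_one (fun _ _ => (hθ _ _).1)
        fun _ _ => (hθ _ _).2.trans hC.le) (Finset.prod_le_prod (fun _ _ => (hθ _ _).1) fun _ _ => (hθ _ _).2)
        (Finset.prod_nonneg fun _ _ => (hθ _ _).1) zero_le_one).trans (le_of_eq ?_)
      simp
    have hzero : Tendsto (fun m => ∏ l ∈ Finset.Ico z (b + m), θ l n) atTop (𝓝 0) :=
      squeeze_zero (fun m => Finset.prod_nonneg fun _ _ => (hθ _ _).1) hle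
        (tendsto_pow_atTop_nhds_zero_of_lt_one hC0 hC)
    simp only [hpart]
    simpa using tendsto_const_nhds.sub hzero
  have h2 : (fun j => if b ≤ j + b then geomProb θ n z (j + b) else 0) =
      fun j => geomProb θ n z (j + b) := by simp
  rw [← h2, hasSum_nat_add_iff (f := fun w => if b ≤ w then geomProb θ n z w else 0) b] at h1
  have h3 : ∑ i ∈ Finset.range b, (if b ≤ i then geomProb θ n z i else 0) = 0 :=
    Finset.sum_eq_zero fun i hi => if_neg (by simpa using hi)
  rwa [h3, add_zero] at h1

theorem hasSum_geomProb {θ : ℕ → ℕ → ℝ} {C : ℝ} (hC : C < 1)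
    (hθ : ∀ a b, 0 ≤ θ a b ∧ θ a b ≤ C) (n z : ℕ) : HasSum (geomProb θ n z) 1 := by
  have h := hasSum_geomProb_tail hC hθ n (le_refl z)
  rw [Finset.Ico_self, Finset.prod_empty] at h
  convert h using 2 with w
  split_ifs with hw
  · rfl
  · exact if_neg hw

theorem tsum_min_of_lt {g : ℕ → ℝ} {b v : ℕ} (hv : v < b) :
    ∑' w, (if min w b = v then g w else 0) = g v := by
  rw [tsum_eq_single v fun w hw => if_neg (by omega), if_pos (by omega)]

theorem tsum_min_of_gt {g : ℕ → ℝ} {b v : ℕ} (hv : b < v) :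
    ∑' w, (if min w b = v then g w else 0) = 0 := by
  rw [tsum_congr fun w => if_neg (by omega), tsum_zero]

theorem tsum_min_self {θ : ℕ → ℕ → ℝ} {C : ℝ} (hC : C < 1)
    (hθ : ∀ a b, 0 ≤ θ a b ∧ θ a b ≤ C) (n : ℕ) {z b : ℕ} (hzb : z ≤ b) :
    ∑' w, (if min w b = b then geomProb θ n z w else 0) = ∏ l ∈ Finset.Ico z b, θ l n := by
  rw [← (hasSum_geomProb_tail hC hθ n hzb).tsum_eq]
  refine tsum_congr fun w => ?_
  simp only [min_eq_right_iff]

/-! ### The two update rules -/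

theorem setAt_self (y : ℕ → ℕ → ℕ) (i k v : ℕ) : setAt y (i, k) v i k = v := if_pos rfl

theorem setAt_of_ne (y : ℕ → ℕ → ℕ) {i k i' k' : ℕ} (v : ℕ) (h : i' ≠ i ∨ k' ≠ k) :
    setAt y (i, k) v i' k' = y i' k' :=
  if_neg fun e => by rw [Prod.mk.injEq] at e; omega

theorem bernoulliProb_nonneg {θ : ℕ → ℕ → ℝ} (hθ : ∀ a b, 0 ≤ θ a b ∧ θ a b ≤ 1)
    (x y : ℕ → ℕ → ℕ) (i k : ℕ) : 0 ≤ bernoulliProb θ x y i k := by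
  have h1 := (hθ (x i k) (i + k)).1
  have h2 := (hθ (x i k) (i + k)).2
  unfold bernoulliProb
  split_ifs <;> linarith

theorem bernoulliProb_congr (θ : ℕ → ℕ → ℝ) (x y z : ℕ → ℕ → ℕ) (i k : ℕ)
    (h : ∀ i' k', i' ≤ i → k' ≤ k → y i' k' = z i' k') :
    bernoulliProb θ x y i k = bernoulliProb θ x z i k := by
  simp only [bernoulliProb, h i k le_rfl le_rfl, h (i - 1) k (Nat.sub_le _ _) le_rfl,
    h i (k - 1) le_rfl (Nat.sub_le _ _)]

theorem isUpdateRule_bernoulliProb {θ : ℕ → ℕ → ℝ} (hθ : ∀ a b, 0 ≤ θ a b ∧ θ a b ≤ 1)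
    (x : ℕ → ℕ → ℕ) : IsUpdateRule (bernoulliProb θ x) fun _ => 1 where
  nonneg := bernoulliProb_nonneg hθ x
  congr := bernoulliProb_congr θ x
  sum_le y i k s := by
    have h1 := hθ (x i k) (i + k)
    have hp : ∀ v, (1 ≤ i ∧ setAt y (i, k) v (i - 1) k = x i k) ↔ (1 ≤ i ∧ y (i - 1) k = x i k) :=
      fun v => and_congr_right fun hi => by rw [setAt_of_ne _ _ (by omega)]
    have hb : ∀ v, (1 ≤ k ∧ setAt y (i, k) v i (k - 1) = x i k) ↔ (1 ≤ k ∧ y i (k - 1) = x i k) :=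
      fun v => and_congr_right fun hi => by rw [setAt_of_ne _ _ (by omega)]
    simp only [bernoulliProb, hp, hb, setAt_self]
    split_ifs
    · rw [Finset.sum_ite_eq']; split_ifs <;> norm_num
    · rw [Finset.sum_ite_eq']; split_ifs <;> norm_num
    · have h2 : ∀ v, (if v = x i k + 1 then θ (x i k) (i + k) else if v = x i k then
          1 - θ (x i k) (i + k) else 0) = (if v = x i k + 1 then θ (x i k) (i + k) else 0) +
          if v = x i k then 1 - θ (x i k) (i + k) else 0 := by
        intro v
        split_ifs <;> first | omega | simp
      simp only [h2]
      rw [Finset.sum_add_distrib, Finset.sum_ite_eq', Finset.sum_ite_eq']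
      split_ifs <;> linarith

theorem pushedLocation_congr {x y z : ℕ → ℕ → ℕ} {i k : ℕ} (h : 1 ≤ i → y (i - 1) k = z (i - 1) k) :
    pushedLocation x y i k = pushedLocation x z i k := by
  unfold pushedLocation
  split_ifs with hi
  · rw [h hi]
  · rfl

theorem isUpdateRule_geometricProb {θ : ℕ → ℕ → ℝ} {C : ℝ} (hC : C < 1)
    (hθ : ∀ a b, 0 ≤ θ a b ∧ θ a b ≤ C) (x : ℕ → ℕ → ℕ) :
    IsUpdateRule (geometricProb θ x) fun _ => 1 where
  nonneg y i k := by
    unfold geometricProb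
    split_ifs
    · refine tsum_nonneg fun w => ?_
      split_ifs
      · exact geomProb_nonneg hC hθ _ _ _
      · rfl
    · exact geomProb_nonneg hC hθ _ _ _
  congr y z i k h := by
    have hp : pushedLocation x y i k = pushedLocation x z i k :=
      pushedLocation_congr fun _ => h (i - 1) k (Nat.sub_le _ _) le_rfl
    simp only [geometricProb, hp, h i k le_rfl le_rfl]
  sum_le y i k s := by
    have hp : ∀ v, pushedLocation x (setAt y (i, k) v) i k = pushedLocation x y i k := fun v =>
      pushedLocation_congr fun hi => setAt_of_ne _ _ (by omega)
    simp only [geometricProb, hp, setAt_self]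
    set z := pushedLocation x y i k
    have hsum := hasSum_geomProb hC hθ (i + k) z
    have hnn := geomProb_nonneg hC hθ (i + k) z
    split_ifs
    · have hs : ∀ v ∈ s, Summable fun w => if min w (x i (k - 1)) = v then
          geomProb θ (i + k) z w else 0 := fun v _ =>
        Summable.of_nonneg_of_le (fun w => by split_ifs; exacts [hnn w, le_rfl])
          (fun w => by split_ifs; exacts [le_rfl, hnn w]) hsum.summable
      rw [← Summable.tsum_finsetSum hs, ← hsum.tsum_eq]
      -- Each attempted location `w` has a single outcome, so it is counted for at most one `v`.
      refine Summable.tsum_le_tsum (fun w => ?_) (summable_sum hs) hsum.summable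
      rw [Finset.sum_ite_eq]
      split_ifs
      exacts [le_rfl, hnn w]
    · rw [← hsum.tsum_eq]
      exact hsum.summable.sum_le_tsum s fun w _ => hnn w

theorem geometricProb_eq_geomProb {θ : ℕ → ℕ → ℝ} {x y : ℕ → ℕ → ℕ} {i k : ℕ}
    (h : 1 ≤ k → y i k < x i (k - 1)) :
    geometricProb θ x y i k = geomProb θ (i + k) (pushedLocation x y i k) (y i k) := by
  unfold geometricProb
  split_ifs with hk
  · exact tsum_min_of_lt (h hk)
  · rfl

theorem geometricProb_of_gt (θ : ℕ → ℕ → ℝ) {x y : ℕ → ℕ → ℕ} {i k : ℕ} (hk : 1 ≤ k)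
    (h : x i (k - 1) < y i k) : geometricProb θ x y i k = 0 := by
  unfold geometricProb
  rw [if_pos hk]
  exact tsum_min_of_gt h

theorem geometricProb_of_eq {θ : ℕ → ℕ → ℝ} {C : ℝ} (hC : C < 1)
    (hθ : ∀ a b, 0 ≤ θ a b ∧ θ a b ≤ C) {x y : ℕ → ℕ → ℕ} {i k : ℕ} (hk : 1 ≤ k)
    (h : y i k = x i (k - 1)) (hz : pushedLocation x y i k ≤ y i k) :
    geometricProb θ x y i k = ∏ l ∈ Finset.Ico (pushedLocation x y i k) (y i k), θ l (i + k) := by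
  unfold geometricProb
  rw [if_pos hk, h, tsum_min_self hC hθ _ (h ▸ hz)]

theorem bernoulliProb_eq_zero (θ : ℕ → ℕ → ℝ) {x y : ℕ → ℕ → ℕ} {i k : ℕ} (h1 : y i k ≠ x i k)
    (h2 : y i k ≠ x i k + 1) : bernoulliProb θ x y i k = 0 := by
  simp [bernoulliProb, h1, h2]


/-! ### Column weights of conjugate arrays -/

theorem le_pushedLocation (x y : ℕ → ℕ → ℕ) (i k : ℕ) : x i k ≤ pushedLocation x y i k := by
  unfold pushedLocation
  split_ifs
  · exact le_max_left _ _
  · rfl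

/-- The pushed locations of the conjugate column describe the union of the old diagram `i` and the
new diagram `i - 1`. -/
theorem add_lt_pushedLocation_hgtFun_iff {x z : ℕ → ℕ → ℕ} (hx : IsInterlacing x) (hxs : IsStar x)
    (hz : IsInterlacing z) (hzs : IsStar z) (i k l : ℕ) :
    i + k < pushedLocation (hgtFun x) (hgtFun z) i l ↔
      i + l < x i k ∨ (1 ≤ i ∧ i + l ≤ z (i - 1) k) := by
  have h1 := add_lt_hgtFun_iff hx hxs i k l
  have h2 := add_lt_hgtFun_iff hz hzs (i - 1) k l
  unfold pushedLocation
  split_ifs with hi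
  · rw [lt_max_iff]
    omega
  · omega

/-- In one column, the Bernoulli weight of a move is the geometric weight of the conjugate move in
the transposed environment. -/
theorem prod_bernoulliProb {θ : ℕ → ℕ → ℝ} {C : ℝ} (hC : C < 1)
    (hθ : ∀ a b, 0 ≤ θ a b ∧ θ a b ≤ C) {x z : ℕ → ℕ → ℕ} (hx : IsInterlacing x) (hxs : IsStar x)
    (hz : IsInterlacing z) (hzs : IsStar z) (i : ℕ) : ∃ K, ∀ M, K ≤ M →
      ∏ k ∈ Finset.range M, bernoulliProb θ x z i k =
        ∏ l ∈ Finset.range M, geometricProb (transposeEnv θ) (hgtFun x) (hgtFun z) i l := by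
  have hθ' : ∀ a b, 0 ≤ transposeEnv θ a b ∧ transposeEnv θ a b ≤ C := fun a b => hθ b a
  obtain ⟨K1, hK1⟩ := eventually_packed hx hxs i
  obtain ⟨K2, hK2⟩ := eventually_packed hz hzs i
  have dx := add_lt_hgtFun_iff hx hxs i
  have dz := add_lt_hgtFun_iff hz hzs i
  have dp := add_lt_pushedLocation_hgtFun_iff hx hxs hz hzs i
  have lx := hx.le_apply i
  have lz := hz.le_apply i
  have ax := hx.antitone i
  have az := hz.antitone i
  have hnz : ∀ k, 1 ≤ i → z (i - 1) k < z i k := fun k hi => by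
    have := (hz (i - 1) k).2
    rwa [Nat.sub_add_cancel hi] at this
  -- `K1` and `K2` bound the rows of the unpacked particles, `x i 0` and `z i 0` those of the
  -- conjugates.
  refine ⟨max (max K1 K2) (max (x i 0) (z i 0)) + 1, fun M hM => ?_⟩
  -- If some particle does not move by zero or one, both sides vanish. A backward move sends a
  -- conjugate particle to the left of its old location; a move by two or more sends one past the
  -- old location of the particle below it.
  by_cases hS : ∀ k, z i k = x i k ∨ z i k = x i k + 1
  swap
  · obtain ⟨k, hk⟩ := not_forall.1 hS
    have hkM : k < M := by
      by_contra hlt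
      exact hk (Or.inl ((hK2 k (by omega)).trans (hK1 k (by omega)).symm))
    rw [Finset.prod_eq_zero (Finset.mem_range.2 hkM)
      (bernoulliProb_eq_zero θ (fun h => hk (Or.inl h)) fun h => hk (Or.inr h))]
    symm
    have ax0 := ax (Nat.zero_le k)
    have az0 := az (Nat.zero_le k)
    have lxk := lx k
    have lzk := lz k
    rcases Nat.lt_or_ge (z i k) (x i k) with hlt | hge
    · have h1 := (dx k (z i k - i)).2 (by omega)
      have h2 := (dz k (z i k - i)).not.2 (by omega)
      refine Finset.prod_eq_zero (i := z i k - i) (Finset.mem_range.2 (by omega)) ?_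
      have h3 := le_pushedLocation (hgtFun x) (hgtFun z) i (z i k - i)
      rw [geometricProb_eq_geomProb, geomProb, if_neg (by omega)]
      intro hl
      have h4 := (hgtFun_interlacing hx hxs).antitone i (show z i k - i - 1 ≤ z i k - i by omega)
      omega
    · have h1 := (dz k (x i k + 1 - i)).2 (by omega)
      have h2 := (dx k (x i k - i)).not.2 (by omega)
      refine Finset.prod_eq_zero (i := x i k + 1 - i) (Finset.mem_range.2 (by omega)) ?_
      refine geometricProb_of_gt _ (by omega) ?_
      rw [show x i k + 1 - i - 1 = x i k - i by omega]
      omega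
  -- `F k l` is the Bernoulli factor of particle `k` if it starts at location `i + l`, and `1`
  -- otherwise, so the product can be regrouped by `l`. The particles starting at `i + l` form an
  -- interval of rows: first the pushed ones (factor `1`), then from `Z - i` to `T - i` the free
  -- movers (factor `θ`), then possibly one that stays freely (factor `1 - θ`), and above it only
  -- blocked ones (factor `1`). This is the geometric weight of the conjugate particle `l` moving
  -- from `Z` to `T`.
  · set F : ℕ → ℕ → ℝ := fun k l =>
      if x i k = i + l then
        if z i k = i + l + 1 then
          if 1 ≤ i ∧ z (i - 1) k = i + l then 1 else θ (i + l) (i + k)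
        else if k = 0 ∨ i + l < z i (k - 1) then 1 - θ (i + l) (i + k) else 1
      else 1 with hF
    have hB : ∀ k ∈ Finset.range M, bernoulliProb θ x z i k = ∏ l ∈ Finset.range M, F k l := by
      intro k _
      have ax0 := ax (Nat.zero_le k)
      have lxk := lx k
      have hSk := hS k
      have e : i + (x i k - i) = x i k := by omega
      rw [Finset.prod_eq_single (x i k - i)]
      · simp only [hF, e, if_true, bernoulliProb]
        have h1 := hnz k
        have h2 := az (Nat.sub_le k 1)
        split_ifs <;> first | rfl | omega
      · intro l _ hl
        exact if_neg (by omega)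
      · intro h
        exact absurd (Finset.mem_range.2 (by omega)) h
    rw [Finset.prod_congr rfl hB, Finset.prod_comm]
    refine Finset.prod_congr rfl fun l hl => ?_
    set Z := pushedLocation (hgtFun x) (hgtFun z) i l with hZdef
    set T := hgtFun z i l with hTdef
    have hZi : i ≤ Z := (le_hgtFun x i l).trans (le_pushedLocation _ _ _ _)
    have hTi : i ≤ T := le_hgtFun z i l
    have hZT : Z ≤ T := by
      by_contra hlt
      have h1 := (dp (T - i) l).1 (by omega)
      have h2 := (dz (T - i) l).not.1 (by omega)
      have h3 := hS (T - i)
      have h4 := hnz (T - i)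
      omega
    have hTM : T - i < M := by
      by_contra hlt
      have h1 := (dz (M - 1) l).1 (by omega)
      have h2 := hK2 (M - 1) (by omega)
      omega
    have hTb : 1 ≤ l → T ≤ hgtFun x i (l - 1) := by
      intro hl1
      by_contra hlt
      have h0 := le_hgtFun x i (l - 1)
      have h1 := (dz (hgtFun x i (l - 1) - i) l).1 (by omega)
      have h2 := (dx (hgtFun x i (l - 1) - i) (l - 1)).not.1 (by omega)
      have h3 := hS (hgtFun x i (l - 1) - i)
      omega
    have hFl : ∀ k ∈ Finset.range M, F k l =
        (if k ∈ Finset.Ico (Z - i) (T - i) then θ (i + l) (i + k) else 1) *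
          if T - i = k then if l = 0 ∨ T < hgtFun x i (l - 1) then 1 - θ (i + l) (i + k) else 1
          else 1 := by
      intro k _
      have h1 := dp k l
      have h2 := dz k l
      have h3 := dz (k - 1) l
      have h4 := dx k (l - 1)
      have h5 := hS k
      have h6 := hnz k
      have h7 := lx k
      simp only [Finset.mem_Ico, hF]
      by_cases hkT : T - i = k
      · rw [if_neg (show ¬ (Z - i ≤ k ∧ k < T - i) by omega), if_pos hkT, one_mul]
        split_ifs <;> first | rfl | omega
      · rw [if_neg hkT, mul_one]
        split_ifs <;> first | rfl | omega
    rw [Finset.prod_congr rfl hFl, Finset.prod_mul_distrib, Finset.prod_ite_mem,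
      Finset.prod_ite_eq, if_pos (Finset.mem_range.2 hTM),
      Finset.inter_eq_right.2 fun k hk => Finset.mem_range.2
        (by have := (Finset.mem_Ico.1 hk).2; omega)]
    have hshift : ∏ k ∈ Finset.Ico (Z - i) (T - i), θ (i + l) (i + k) =
        ∏ w ∈ Finset.Ico Z T, transposeEnv θ w (i + l) := by
      rw [Finset.prod_Ico_add (fun w => θ (i + l) w)]
      congr 2 <;> omega
    have e : i + (T - i) = T := by omega
    rw [hshift, e]
    -- If `T` is short of the old location of the particle below, some particle stays freely and the
    -- weight is a point mass. Otherwise all particles at `i + l` move, the factor `1 - θ` is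
    -- absent, and the weight is the geometric tail stopped there.
    split_ifs with hc
    · rw [geometricProb_eq_geomProb fun _ => by omega, geomProb, if_pos hZT]
      rfl
    · rw [mul_one, geometricProb_of_eq hC hθ' (by omega) (by omega) hZT]

theorem prod_geometricProb {θ : ℕ → ℕ → ℝ} {C : ℝ} (hC : C < 1)
    (hθ : ∀ a b, 0 ≤ θ a b ∧ θ a b ≤ C) {x z : ℕ → ℕ → ℕ} (hx : IsInterlacing x) (hxs : IsStar x)
    (hz : IsInterlacing z) (hzs : IsStar z) (i : ℕ) : ∃ K, ∀ M, K ≤ M →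
      ∏ k ∈ Finset.range M, geometricProb θ x z i k =
        ∏ l ∈ Finset.range M, bernoulliProb (transposeEnv θ) (hgtFun x) (hgtFun z) i l := by
  obtain ⟨K, hK⟩ := prod_bernoulliProb hC (θ := transposeEnv θ) (fun a b => hθ b a)
    (hgtFun_interlacing hx hxs) (hgtFun_star hx) (hgtFun_interlacing hz hzs) (hgtFun_star hz) i
  refine ⟨K, fun M hM => ?_⟩
  rw [hK M hM, hgtFun_hgtFun hx hxs, hgtFun_hgtFun hz hzs]
  rfl

/-! ### Both dynamics preserve eventually packed arrays -/

/-- No particle passes the old location of the one below, so a column packed from row `K` on is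
packed from row `K + 1` on after the step. -/
theorem ae_star_of_geometric {ν : Measure IA} [IsFiniteMeasure ν] {θ : ℕ → ℕ → ℝ}
    {x : ℕ → ℕ → ℕ} (hx : IsInterlacing x) (hxs : IsStar x)
    (h : HasWeights ν (geometricProb θ x)) : ∀ᵐ z ∂ν, IsStar z.1 := by
  have h1 : ∀ i k, ∀ᵐ z : IA ∂ν, z.1 i (k + 1) ≤ x i k := by
    intro i k
    have h2 : ν.real {z | x i k < z.1 i (k + 1)} ≤ 0 := by
      refine h.measureReal_le (i + k + 2) (Q := fun w => x i k < w i (k + 1)) ?_ fun F hF _ => ?_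
      · intro w w' hw hlt
        rwa [← hw i (k + 1) (by omega)]
      · refine (Finset.sum_eq_zero fun w hw => ?_).le
        exact Finset.prod_eq_zero (i := (i, k + 1)) (mem_triangle.2 (by simp only; omega))
          (geometricProb_of_gt θ (by omega) (by simpa using hF w hw))
    have h3 : ν {z | x i k < z.1 i (k + 1)} = 0 :=
      (measureReal_eq_zero_iff (measure_ne_top _ _)).1 (le_antisymm h2 measureReal_nonneg)
    filter_upwards [measure_eq_zero_iff_ae_notMem.1 h3] with z hz
    simpa using hz
  have h2 := ae_all_iff.2 fun i => ae_all_iff.2 (h1 i)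
  filter_upwards [h2] with z hz i _
  obtain ⟨K, hK⟩ := eventually_packed hx hxs i
  refine ⟨K + 1, fun k hk => le_antisymm ?_ (z.2.le_apply i k)⟩
  have h3 := hz i (k - 1)
  rw [Nat.sub_add_cancel (by omega)] at h3
  exact h3.trans (hK (k - 1) (by omega)).le

/-- On this event the `m` particles start at `i` and none is pushed, because the neighbours end at
`i - 1`. Each must jump by itself, with probability at most `C`. -/
theorem measureReal_bernoulli_unpacked_le {ν : Measure IA} [IsFiniteMeasure ν] {θ : ℕ → ℕ → ℝ}
    {C : ℝ} (hC : C < 1) (hθ : ∀ a b, 0 ≤ θ a b ∧ θ a b ≤ C) {x : ℕ → ℕ → ℕ}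
    (h : HasWeights ν (bernoulliProb θ x)) {i K : ℕ} (hK : ∀ k, K ≤ k → x i k = i) (m : ℕ) :
    ν.real {z | ∀ k, K ≤ k → k < K + m → (1 ≤ i → z.1 (i - 1) k = i - 1) ∧ z.1 i k ≠ i} ≤ C ^ m := by
  classical
  have hC0 : 0 ≤ C := (hθ 0 0).1.trans (hθ 0 0).2
  have hθ1 : ∀ a b, 0 ≤ θ a b ∧ θ a b ≤ 1 := fun a b => ⟨(hθ a b).1, (hθ a b).2.trans hC.le⟩
  have hq := isUpdateRule_bernoulliProb hθ1 x
  set S : Finset (ℕ × ℕ) := {i} ×ˢ Finset.Ico K (K + m) with hS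
  have hmemS : ∀ i' k', (i', k') ∈ S ↔ i' = i ∧ K ≤ k' ∧ k' < K + m := by
    intro i' k'; simp only [hS, Finset.mem_product, Finset.mem_singleton, Finset.mem_Ico]
  set good : (ℕ → ℕ → ℕ) → ℕ → Prop := fun w k => (1 ≤ i → w (i - 1) k = i - 1) ∧ w i k ≠ i with hgood
  -- Discarding the forbidden outcomes on `S` leaves an update rule of mass at most `C` at each site
  -- of `S`, to which marginalisation applies.
  set q : (ℕ → ℕ → ℕ) → ℕ → ℕ → ℝ := fun w i' k' =>
    if (i', k') ∈ S ∧ ¬ good w k' then 0 else bernoulliProb θ x w i' k' with hqdef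
  have hq' : IsUpdateRule q fun c => if c ∈ S then C else 1 := by
    refine ⟨fun y i' k' => ?_, fun y z i' k' hyz => ?_, fun y i' k' s => ?_⟩
    · simp only [hqdef]
      split_ifs
      exacts [le_rfl, hq.nonneg _ _ _]
    · have h1 : ((i', k') ∈ S ∧ ¬ good y k') ↔ ((i', k') ∈ S ∧ ¬ good z k') := by
        refine and_congr_right fun hmem => ?_
        obtain ⟨rfl, -⟩ := (hmemS _ _).1 hmem
        simp only [hgood, hyz i' k' le_rfl le_rfl, hyz (i' - 1) k' (Nat.sub_le _ _) le_rfl]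
      simp only [hqdef, h1, hq.congr y z i' k' hyz]
    · by_cases hmem : (i', k') ∈ S
      · obtain ⟨rfl, hk1, hk2⟩ := (hmemS _ _).1 hmem
        have hx := hK k' hk1
        rw [if_pos hmem]
        have hle : ∀ v, q (setAt y (i', k') v) i' k' ≤ if v = i' + 1 then C else 0 := by
          intro v
          by_cases h1 : good (setAt y (i', k') v) k'
          · simp only [hqdef, h1, not_true, and_false, if_false]
            split_ifs with h2
            · subst h2
              have h3 := (hθ (x i' k') (i' + k')).2
              have h4 : ¬ (1 ≤ i' ∧ setAt y (i', k') (i' + 1) (i' - 1) k' = x i' k') := by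
                rintro ⟨h5, h6⟩
                have := h1.1 h5
                omega
              unfold bernoulliProb
              rw [if_neg h4, setAt_self, hx]
              rw [hx] at h3
              split_ifs <;> omega
            · have h3 := h1.2
              rw [setAt_self] at h3
              rw [bernoulliProb_eq_zero] <;> rw [setAt_self, hx] <;> omega
          · simp only [hqdef, hmem, h1, not_false_eq_true, and_self, if_true]
            split_ifs
            exacts [hC0, le_rfl]
        refine (Finset.sum_le_sum fun v _ => hle v).trans ?_
        rw [Finset.sum_ite_eq']
        split_ifs
        exacts [le_rfl, hC0]
      · rw [if_neg hmem]
        simp only [hqdef, hmem, false_and, if_false]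
        exact hq.sum_le y i' k' s
  obtain ⟨N, hN⟩ := exists_subset_triangle (S ∪ {(i, K + m)})
  refine h.measureReal_le N (Q := fun w => ∀ k, K ≤ k → k < K + m → good w k) ?_ fun F hF hinj => ?_
  · intro w w' hw hg k hk1 hk2
    have h1 := mem_triangle.1 (hN (Finset.mem_union_left _ ((hmemS i k).2 ⟨rfl, hk1, hk2⟩)))
    simp only at h1
    have h2 := hg k hk1 hk2
    simp only [hgood] at h2 ⊢
    rwa [← hw (i - 1) k (by omega), ← hw i k h1]
  · have h1 : ∀ w ∈ F, ∏ c ∈ triangle N, bernoulliProb θ x w c.1 c.2 =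
        ∏ c ∈ triangle N, q w c.1 c.2 := by
      intro w hw
      refine Finset.prod_congr rfl fun c _ => ?_
      simp only [hqdef]
      rw [if_neg]
      rintro ⟨h2, h3⟩
      obtain ⟨-, h4, h5⟩ := (hmemS _ _).1 h2
      exact h3 (hF w hw _ h4 h5)
    rw [Finset.sum_congr rfl h1]
    have h2 := sum_prod_le hq' (A := ∅) (by simp [IsLowerSet]) (isLowerSet_triangle N)
      (Finset.empty_subset _) 0 F (fun _ _ c hc => absurd hc (by simp)) hinj
    refine h2.trans (le_of_eq ?_)
    rw [Finset.prod_empty, one_mul, Finset.sdiff_empty, Finset.prod_ite_mem,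
      Finset.inter_eq_right.2 fun c hc => hN (Finset.mem_union_left _ hc), Finset.prod_const]
    simp [hS]

/-- Induction on the column: once column `i - 1` is packed far out, infinitely many particles of
column `i` would have to jump unaided. Column `0` is never pushed. -/
theorem ae_star_of_bernoulli {ν : Measure IA} [IsFiniteMeasure ν] {θ : ℕ → ℕ → ℝ} {C : ℝ}
    (hC : C < 1) (hθ : ∀ a b, 0 ≤ θ a b ∧ θ a b ≤ C) {x : ℕ → ℕ → ℕ} (hx : IsInterlacing x)
    (hxs : IsStar x) (h : HasWeights ν (bernoulliProb θ x)) : ∀ᵐ z ∂ν, IsStar z.1 := by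
  have hC0 : 0 ≤ C := (hθ 0 0).1.trans (hθ 0 0).2
  have key : ∀ i K, (∀ k, K ≤ k → x i k = i) →
      ∀ᵐ z : IA ∂ν, ¬ ∀ k, K ≤ k → (1 ≤ i → z.1 (i - 1) k = i - 1) ∧ z.1 i k ≠ i := by
    intro i K hK
    refine measure_eq_zero_iff_ae_notMem.1 ((measureReal_eq_zero_iff (measure_ne_top _ _)).1
      (le_antisymm ?_ measureReal_nonneg))
    refine ge_of_tendsto' (tendsto_pow_atTop_nhds_zero_of_lt_one hC0 hC) fun m => ?_
    refine le_trans (measureReal_mono ?_) (measureReal_bernoulli_unpacked_le hC hθ h hK m)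
    intro z hz k hk _
    have hz' : ∀ k, K ≤ k → (1 ≤ i → z.1 (i - 1) k = i - 1) ∧ z.1 i k ≠ i := hz
    exact hz' k hk
  have step : ∀ i, (∀ᵐ z : IA ∂ν, 1 ≤ i → ∃ K, ∀ k, K ≤ k → z.1 (i - 1) k = i - 1) →
      ∀ᵐ z : IA ∂ν, ∃ K, ∀ k, K ≤ k → z.1 i k = i := by
    intro i hi
    obtain ⟨K0, hK0⟩ := eventually_packed hx hxs i
    filter_upwards [hi, ae_all_iff.2 fun K => key i (max K K0) fun k hk => hK0 k (by omega)]
      with z hz hnot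
    obtain ⟨K, hK⟩ : ∃ K, 1 ≤ i → ∀ k, K ≤ k → z.1 (i - 1) k = i - 1 := by
      by_cases h1 : 1 ≤ i
      · obtain ⟨K, hK⟩ := hz h1
        exact ⟨K, fun _ => hK⟩
      · exact ⟨0, fun h => absurd h h1⟩
    have hnot' := hnot K
    push Not at hnot'
    obtain ⟨k, hk1, hk2⟩ := hnot'
    have h1 := hk2 fun hi => hK hi k (by omega)
    exact ⟨k, fun m hm => le_antisymm ((z.2.antitone i hm).trans h1.le) (z.2.le_apply i m)⟩
  have hcol : ∀ i, ∀ᵐ z : IA ∂ν, ∃ K, ∀ k, K ≤ k → z.1 i k = i := by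
    intro i
    induction i with
    | zero => exact step 0 (Eventually.of_forall fun _ h => absurd h (by omega))
    | succ i ih => exact step (i + 1) (ih.mono fun z hz _ => hz)
  filter_upwards [ae_all_iff.2 hcol] with z hz i _
  exact hz i


/-! ### Markov chains with given cylinder weights -/

theorem standardBorelSpace_IA : StandardBorelSpace IA := by
  have e : {x : ℕ → ℕ → ℕ | IsInterlacing x} =
      ⋂ i, ⋂ k, {x | x i (k + 1) ≤ x i k} ∩ {x | x i k < x (i + 1) k} := by
    ext x; simp [IsInterlacing]
  have hm : ∀ i k, Measurable fun x : ℕ → ℕ → ℕ => x i k := fun i k =>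
    (measurable_pi_apply k).comp (measurable_pi_apply i)
  have h : MeasurableSet {x : ℕ → ℕ → ℕ | IsInterlacing x} := by
    rw [e]
    exact .iInter fun i => .iInter fun k =>
      (measurableSet_le (hm _ _) (hm _ _)).inter (measurableSet_lt (hm _ _) (hm _ _))
  exact h.standardBorel

theorem nonempty_IA : Nonempty IA := ⟨⟨fun i _ => i, fun i _ => ⟨le_rfl, Nat.lt_succ_self i⟩⟩⟩

/-- Finitely supported patterns realise every cylinder and are countable, so almost sure identities
can be imposed on all of them at once. -/
theorem hasWeights_of_finsupp {ν : Measure IA} {q : (ℕ → ℕ → ℕ) → ℕ → ℕ → ℝ}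
    (hq : IsUpdateRule q fun _ => 1)
    (h : ∀ (N : ℕ) (w : ℕ × ℕ →₀ ℕ), ν.real {z | AgreeBelow N z.1 fun i k => w (i, k)} =
      ∏ c ∈ triangle N, q (fun i k => w (i, k)) c.1 c.2) : HasWeights ν q := by
  intro N y
  set w : ℕ × ℕ →₀ ℕ := Finsupp.onFinset (triangle N)
    (fun c => if c ∈ triangle N then y c.1 c.2 else 0) (fun c hc => by
      by_contra h; simp [h] at hc) with hw
  have hag : AgreeOn (triangle N) (fun i k => w (i, k)) y := fun c hc => by
    rw [hw]; simp [Finsupp.onFinset_apply, hc]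
  rw [← hag.prod_eq hq (isLowerSet_triangle N), ← h N w]
  congr 1
  ext z
  simp only [Set.mem_ofPred_eq, agreeBelow_iff_agreeOn]
  exact ⟨fun hz c hc => (hz c hc).trans (hag c hc).symm, fun hz c hc => (hz c hc).trans (hag c hc)⟩

/-- The conditional law of the next array. -/
theorem exists_conditional_law {Ω : Type*} {m : MeasurableSpace Ω} [m0 : MeasurableSpace Ω]
    {P : Measure Ω} [IsProbabilityMeasure P] (hm : m ≤ m0) {X Y : Ω → IA}
    (hY : Measurable Y) {q : (ℕ → ℕ → ℕ) → (ℕ → ℕ → ℕ) → ℕ → ℕ → ℝ}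
    (hq : ∀ x, IsUpdateRule (q x) fun _ => 1)
    (h : ∀ (N : ℕ) (y : ℕ → ℕ → ℕ),
      P[Set.indicator {ω | AgreeBelow N (Y ω).1 y} (fun _ => (1 : ℝ)) | m] =ᵐ[P]
        fun ω => ∏ i ∈ Finset.range N, ∏ k ∈ Finset.range (N - i), q (X ω).1 y i k) :
    ∃ κ : Ω → Measure IA, (∀ ω, IsProbabilityMeasure (κ ω)) ∧
      (∀ᵐ ω ∂P, HasWeights (κ ω) (q (X ω).1)) ∧
      ∀ s : Set IA, MeasurableSet s →
        P[Set.indicator (Y ⁻¹' s) (fun _ => (1 : ℝ)) | m] =ᵐ[P] fun ω => (κ ω).real s := by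
  have := standardBorelSpace_IA
  have := nonempty_IA
  -- Conditioning on the identity map into `Ω` with the sigma-algebra `m` gives a regular
  -- conditional law given `m`.
  let κ := @ProbabilityTheory.condDistrib Ω Ω IA _ _ _ m0 m Y id P _
  have hκ : ∀ s : Set IA, MeasurableSet s →
      P[Set.indicator (Y ⁻¹' s) (fun _ => (1 : ℝ)) | m] =ᵐ[P] fun ω => (κ ω).real s := by
    intro s hs
    have h1 := @ProbabilityTheory.condDistrib_ae_eq_condExp Ω Ω IA _ _ _ m0 P _ id Y m s
      (measurable_id'' hm) hY hs
    rw [MeasurableSpace.comap_id] at h1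
    exact h1.symm
  refine ⟨fun ω => κ ω, fun ω => inferInstance, ?_, hκ⟩
  have hall : ∀ᵐ ω ∂P, ∀ (N : ℕ) (w : ℕ × ℕ →₀ ℕ),
      (κ ω).real {z | AgreeBelow N z.1 fun i k => w (i, k)} =
        ∏ c ∈ triangle N, q (X ω).1 (fun i k => w (i, k)) c.1 c.2 := by
    simp only [ae_all_iff]
    intro N w
    filter_upwards [h N fun i k => w (i, k), hκ _ (measurableSet_agreeBelow N fun i k => w (i, k))]
      with ω h1 h2
    rw [← h2, prod_triangle N]
    exact h1
  filter_upwards [hall] with ω hω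
  exact hasWeights_of_finsupp (hq _) hω

namespace IsSequentialChain

variable {Ω : Type*} [MeasurableSpace Ω] {P : Measure Ω} [IsProbabilityMeasure P]
  {q q' : (ℕ → ℕ → ℕ) → (ℕ → ℕ → ℕ) → ℕ → ℕ → ℝ} {x : IA} {X : ℕ → Ω → IA}

theorem ae_star (h : IsSequentialChain P q x X) (hs : IsStar x.1)
    (hq : ∀ x, IsUpdateRule (q x) fun _ => 1)
    (hstar : ∀ y : IA, IsStar y.1 → ∀ ν : Measure IA, IsProbabilityMeasure ν →
      HasWeights ν (q y.1) → ∀ᵐ z ∂ν, IsStar z.1) :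
    ∀ᵐ ω ∂P, ∀ t, IsStar (X t ω).1 := by
  refine ae_all_iff.2 fun t => ?_
  induction t with
  | zero => exact h.initial.mono fun ω hω => by rw [hω]; exact hs
  | succ t ih =>
    have hm := past_le h.measurable t
    obtain ⟨κ, hκp, hκw, hκ⟩ := exists_conditional_law hm (h.measurable (t + 1)) hq (h.step t)
    have hS : MeasurableSet {z : IA | IsStar z.1}ᶜ := measurableSet_star.compl
    have h1 : ∀ᵐ ω ∂P, (κ ω).real {z : IA | IsStar z.1}ᶜ = 0 := by
      filter_upwards [ih, hκw] with ω h2 h3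
      have := hκp ω
      exact (measureReal_eq_zero_iff (measure_ne_top _ _)).2 (hstar _ h2 _ (hκp ω) h3)
    have h2 : P.real (X (t + 1) ⁻¹' {z : IA | IsStar z.1}ᶜ) = 0 := by
      rw [← integral_indicator_one (h.measurable (t + 1) hS)]
      change ∫ ω, Set.indicator _ (fun _ => (1 : ℝ)) ω ∂P = 0
      rw [← integral_condExp hm, integral_congr_ae (hκ _ hS), integral_congr_ae h1, integral_zero]
    exact (measureReal_eq_zero_iff (measure_ne_top _ _)).1 h2

theorem hgtExt (h : IsSequentialChain P q x X) (hs : IsStar x.1)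
    (hq : ∀ x, IsUpdateRule (q x) fun _ => 1) (hq' : ∀ x, IsUpdateRule (q' x) fun _ => 1)
    (hmeas : ∀ y i k, Measurable fun x : IA => q' x.1 y i k)
    (hstar : ∀ y : IA, IsStar y.1 → ∀ ν : Measure IA, IsProbabilityMeasure ν →
      HasWeights ν (q y.1) → ∀ᵐ z ∂ν, IsStar z.1)
    (hcol : ∀ y z : ℕ → ℕ → ℕ, IsInterlacing y → IsStar y → IsInterlacing z → IsStar z → ∀ i, ∃ K,
      ∀ M, K ≤ M → ∏ k ∈ Finset.range M, q y z i k =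
        ∏ l ∈ Finset.range M, q' (hgtFun y) (hgtFun z) i l) :
    IsSequentialChain P q' (HgtExt x) fun t ω => HgtExt (X t ω) where
  measurable t := measurable_HgtExt.comp (h.measurable t)
  initial := h.initial.mono fun ω hω => by rw [hω]
  step t N y := by
    have hm := past_le h.measurable t
    have hmH : ∀ t, Measurable fun ω => HgtExt (X t ω) := fun t =>
      measurable_HgtExt.comp (h.measurable t)
    obtain ⟨κ, hκp, hκw, hκ⟩ := exists_conditional_law hm (h.measurable (t + 1)) hq (h.step t)
    set E : Set Ω := {ω | AgreeBelow N (HgtExt (X (t + 1) ω)).1 y}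
    set R : Ω → ℝ := fun ω => ∏ i ∈ Finset.range N, ∏ k ∈ Finset.range (N - i),
      q' (HgtExt (X t ω)).1 y i k with hR
    have h1 : P[Set.indicator E (fun _ => (1 : ℝ)) | past X t] =ᵐ[P] R := by
      have hS : MeasurableSet (HgtExt ⁻¹' {z : IA | AgreeBelow N z.1 y}) :=
        measurable_HgtExt (measurableSet_agreeBelow N y)
      refine (hκ _ hS).trans ?_
      filter_upwards [hκw, h.ae_star hs hq hstar] with ω hw hst
      have := hκp ω
      have h2 := hw.map_hgtExt (hq _) (hq' (hgtFun (X t ω).1)) (hstar _ (hst t) _ (hκp ω) hw)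
        (fun z hz hzs => hcol _ z (X t ω).2 (hst t) hz hzs) N y
      rw [map_measureReal_apply measurable_HgtExt (measurableSet_agreeBelow N y)] at h2
      rw [h2, prod_triangle N]
      simp only [hR, HgtExt_of_star (hst t)]
    -- The weight depends on the past only through the current conjugate array, so projecting to the
    -- smaller past does not change it; this is the Markov property of the image.
    have hRm : StronglyMeasurable[past (fun t ω => HgtExt (X t ω)) t] R := by
      refine Measurable.stronglyMeasurable ?_
      refine Finset.measurable_prod _ fun i _ => Finset.measurable_prod _ fun k _ => ?_
      exact (hmeas y i k).comp (measurable_past (fun t ω => HgtExt (X t ω)) le_rfl)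
    have hRi : Integrable R P := integrable_condExp.congr h1
    have h2 := condExp_condExp_of_le (μ := P) (f := Set.indicator E fun _ => (1 : ℝ))
      (past_comp_le X measurable_HgtExt t) hm
    have h3 := condExp_congr_ae (m := past (fun t ω => HgtExt (X t ω)) t) h1
    rw [condExp_of_stronglyMeasurable (past_le hmH t) hRm hRi] at h3
    exact h2.symm.trans h3

end IsSequentialChain

theorem measurable_bernoulliProb (θ : ℕ → ℕ → ℝ) (y : ℕ → ℕ → ℕ) (i k : ℕ) :
    Measurable fun x : IA => bernoulliProb θ x.1 y i k :=
  measurable_of_agreeBelow (N := i + k + 1) (f := fun x => bernoulliProb θ x y i k)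
    fun x z h => by simp only [bernoulliProb, h i k (by omega)]

theorem measurable_geometricProb (θ : ℕ → ℕ → ℝ) (y : ℕ → ℕ → ℕ) (i k : ℕ) :
    Measurable fun x : IA => geometricProb θ x.1 y i k :=
  measurable_of_agreeBelow (N := i + k + 1) (f := fun x => geometricProb θ x y i k)
    fun x z h => by
      simp only [geometricProb, pushedLocation, h i k (by omega), h i (k - 1) (by omega)]

theorem HgtExt_coe (x : IAstar) : HgtExt x.1 = (Hgt x).1 := dif_pos x.2

end HgtDuality

end

/-! ### The duality theorem -/

theorem mainTheorem9 {Ω : Type*} [MeasurableSpace Ω] (P : MeasureTheory.Measure Ω)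
    [MeasureTheory.IsProbabilityMeasure P] (θ : ℕ → ℕ → ℝ) (x : HgtDuality.IAstar) :
    Function.Involutive HgtDuality.Hgt ∧
    (HgtDuality.ContinuousEnv θ → ∀ X : NNReal → Ω → HgtDuality.IA,
      HgtDuality.IsPureBirth P θ x.1 X →
        (∀ᵐ ω ∂P, ∀ t, HgtDuality.IsStar (X t ω).1) ∧
        HgtDuality.IsPureBirth P (HgtDuality.transposeEnv θ) (HgtDuality.Hgt x).1
          (fun t ω => HgtDuality.HgtExt (X t ω))) ∧
    (HgtDuality.DiscreteEnv θ → ∀ X : ℕ → Ω → HgtDuality.IA,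
      HgtDuality.IsBernoulli P θ x.1 X →
        (∀ᵐ ω ∂P, ∀ t, HgtDuality.IsStar (X t ω).1) ∧
        HgtDuality.IsWarrenWindridge P (HgtDuality.transposeEnv θ) (HgtDuality.Hgt x).1
          (fun t ω => HgtDuality.HgtExt (X t ω))) ∧
    (HgtDuality.DiscreteEnv θ → ∀ X : ℕ → Ω → HgtDuality.IA,
      HgtDuality.IsWarrenWindridge P θ x.1 X →
        (∀ᵐ ω ∂P, ∀ t, HgtDuality.IsStar (X t ω).1) ∧
        HgtDuality.IsBernoulli P (HgtDuality.transposeEnv θ) (HgtDuality.Hgt x).1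
          (fun t ω => HgtDuality.HgtExt (X t ω))) := by
  refine ⟨HgtDuality.Hgt_involutive, ?_, ?_, ?_⟩ <;> rw [← HgtDuality.HgtExt_coe]
  · rintro ⟨c, C, hc, hθ⟩ X hX
    have hθ' : ∀ a b, 0 ≤ θ a b ∧ θ a b ≤ C := fun a b => ⟨hc.le.trans (hθ a b).1, (hθ a b).2⟩
    exact ⟨hX.ae_star x.2 hθ', hX.hgtExt x.2 hθ'⟩
  · rintro ⟨c, C, hc, hC, hθ⟩ X hX
    have hθ' : ∀ a b, 0 ≤ θ a b ∧ θ a b ≤ C := fun a b => ⟨hc.le.trans (hθ a b).1, (hθ a b).2⟩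
    have hq := HgtDuality.isUpdateRule_bernoulliProb
      (fun a b => ⟨(hθ' a b).1, (hθ' a b).2.trans hC.le⟩ : ∀ a b, 0 ≤ θ a b ∧ θ a b ≤ 1)
    have hq' := HgtDuality.isUpdateRule_geometricProb hC (θ := HgtDuality.transposeEnv θ)
      fun a b => hθ' b a
    have hstar : ∀ y : HgtDuality.IA, HgtDuality.IsStar y.1 →
        ∀ ν : Measure HgtDuality.IA, IsProbabilityMeasure ν →
          HgtDuality.HasWeights ν (HgtDuality.bernoulliProb θ y.1) →
            ∀ᵐ z ∂ν, HgtDuality.IsStar z.1 :=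
      fun y hy ν _ h => HgtDuality.ae_star_of_bernoulli hC hθ' y.2 hy h
    exact ⟨hX.ae_star x.2 hq hstar, hX.hgtExt x.2 hq hq'
      (HgtDuality.measurable_geometricProb _) hstar
      fun _ _ hy hys hz hzs => HgtDuality.prod_bernoulliProb hC hθ' hy hys hz hzs⟩
  · rintro ⟨c, C, hc, hC, hθ⟩ X hX
    have hθ' : ∀ a b, 0 ≤ θ a b ∧ θ a b ≤ C := fun a b => ⟨hc.le.trans (hθ a b).1, (hθ a b).2⟩
    have hq := HgtDuality.isUpdateRule_geometricProb hC hθ'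
    have hq' := HgtDuality.isUpdateRule_bernoulliProb (θ := HgtDuality.transposeEnv θ)
      fun a b => ⟨(hθ' b a).1, (hθ' b a).2.trans hC.le⟩
    have hstar : ∀ y : HgtDuality.IA, HgtDuality.IsStar y.1 →
        ∀ ν : Measure HgtDuality.IA, IsProbabilityMeasure ν →
          HgtDuality.HasWeights ν (HgtDuality.geometricProb θ y.1) →
            ∀ᵐ z ∂ν, HgtDuality.IsStar z.1 :=
      fun y hy ν _ h => HgtDuality.ae_star_of_geometric y.2 hy h
    exact ⟨hX.ae_star x.2 hq hstar, hX.hgtExt x.2 hq hq'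
      (HgtDuality.measurable_bernoulliProb _) hstar
      fun _ _ hy hys hz hzs => HgtDuality.prod_geometricProb hC hθ' hy hys hz hzs⟩
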